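/- Proposition 4.5 (classification of 3-dimensional weak bialgebras). A weak bialgebra over $\mathbb C$ is a quintuple $(V,m,\eta,\Delta,\varepsilon)$ in which $(V,m,\eta)$ is a unital associative algebra (write $xy=m(x\otimes y)$, $1=\eta(1)$), $(V,\Delta,\varepsilon)$ is a coassociative counital coalgebra, and, for all $x,y,z\in V$, $$\Delta(xy)=\Delta(x)\Delta(y),\qquad (\Delta\otimes\mathrm{id})\Delta(1)=(\Delta(1)\otimes 1)(1\otimes\Delta(1))=(1\otimes\Delta(1))(\Delta(1)\otimes 1),\qquad \varepsilon(xyz)=\varepsilon(xy_{(1)})\,\varepsilon(y_{(2)}z).$$ An isomorphism of weak bialgebras is a linear bijection compatible with $m,\eta,\Delta,\varepsilon$. Let $e_1,e_2,e_3$ be the standard basis of $\mathbb C^3$, and define three multiplications on $\mathbb C^3$ with unit $e_1$ by - $m_1$: $e_2e_2=e_2$, $e_2e_3=e_3e_2=e_3e_3=e_3$; - $m_2$: $e_2e_2=e_2$, $e_2e_3=e_3e_2=e_3$, $e_3e_3=0$; - $m_5$: $e_2e_2=e_2$, $e_2e_3=e_3$, $e_3e_2=e_3e_3=0$. Each of the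 following twenty quintuples on $\mathbb C^3$ (with unit $e_1$) is a weak bialgebra, and every weak bialgebra over $\mathbb C$ of dimension $3$ is isomorphic to one of them. Here $\varepsilon=(c_1,c_2,c_3)$ means $\varepsilon(e_i)=c_i$. With multiplication $m_1$: 1. $\Delta(e_1)=e_1\otimes e_1$, $\Delta(e_2)=e_1\otimes(e_1-e_3)+e_2\otimes(2e_3-e_2)+e_3\otimes(2e_2-e_3-e_1)$, $\Delta(e_3)=e_1\otimes(e_2-e_3)+e_2\otimes(e_1-2e_2+e_3)+e_3\otimes(e_2+e_3-e_1)$, $\varepsilon=(1,1,1)$. 2. $\Delta(e_i)=e_i\otimes e_i$ for $i=1,2,3$, $\varepsilon=(1,1,1)$. 3. $\Delta(e_1)=e_1\otimes e_1$, $\Delta(e_2)=e_2\otimes e_2$, $\Delta(e_3)=(e_2-e_3)\otimes e_3+e_3\otimes(e_2-e_3)$, $\varepsilon=(1,1,0)$. 4. $\Delta(e_1)=e_1\otimes e_1$, $\Delta(e_2)=(e_2-e_3)\otimes e_3+e_3\otimes e_2$, $\Delta(e_3)=e_3\otimes e_3$, $\varepsilon=(1,1,1)$. 5. $\Delta(e_1)=e_1\otimes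 e_1$, $\Delta(e_2)=e_2\otimes e_2+(e_1-e_2)\otimes e_3$, $\Delta(e_3)=(e_1-e_3)\otimes e_3+e_3\otimes e_2$, $\varepsilon=(1,1,0)$. 6. $\Delta(e_1)=e_1\otimes e_1$, $\Delta(e_2)=e_2\otimes e_2+e_3\otimes(e_1-e_2)$, $\Delta(e_3)=e_2\otimes e_3+e_3\otimes e_1-e_3\otimes e_3$, $\varepsilon=(1,1,0)$. 7. $\Delta(e_1)=e_1\otimes e_1$, $\Delta(e_2)=(e_1-e_2)\otimes(e_1-e_2)+e_2\otimes e_2$, $\Delta(e_3)=e_3\otimes e_3$, $\varepsilon=(1,1,1)$. 8. $\Delta(e_1)=(e_1-e_2)\otimes(e_1-e_2)+e_2\otimes e_2$, $\Delta(e_2)=e_2\otimes e_2$, $\Delta(e_3)=e_3\otimes e_3$, $\varepsilon=(2,1,1)$. 9. $\Delta(e_1)=(e_1-e_2)\otimes(e_1-e_2)+e_2\otimes e_2$, $\Delta(e_2)=e_2\otimes e_2$, $\Delta(e_3)=(e_2-e_3)\otimes e_3+e_3\otimes(e_2-e_3)$, $\varepsilon=(2,1,0)$. 10. $\Delta(e_1)=(e_1-e_2)\otimes(e_1-e_2)+(e_2-e_3)\otimes(e_2-e_3)+e_3\otimes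 e_3$, $\Delta(e_2)=(e_2-e_3)\otimes(e_2-e_3)+e_3\otimes e_3$, $\Delta(e_3)=e_3\otimes e_3$, $\varepsilon=(3,2,1)$. 11. $\Delta(e_1)=e_1\otimes(e_2-e_3)+e_3\otimes(e_1-2e_2+2e_3)$, $\Delta(e_2)=(e_2-e_3)\otimes(e_2-e_3)+e_3\otimes e_3$, $\Delta(e_3)=e_3\otimes e_3$, $\varepsilon=(2,2,1)$. With multiplication $m_2$, and in all four cases $\Delta(e_1)=e_1\otimes e_1$, $\Delta(e_2)=e_1\otimes e_2+e_2\otimes e_1-e_2\otimes e_2$, $\varepsilon=(1,0,0)$: 12. $\Delta(e_3)=e_1\otimes e_3+e_3\otimes e_1-e_3\otimes e_2$. 13. $\Delta(e_3)=e_1\otimes e_3-e_2\otimes e_3+e_3\otimes e_1-e_3\otimes e_2+e_3\otimes e_3$. 14. $\Delta(e_3)=e_1\otimes e_3-e_2\otimes e_3+e_3\otimes e_1$. 15. $\Delta(e_3)=e_1\otimes e_3-e_3\otimes e_2+e_3\otimes e_1-e_2\otimes e_3$. With multiplication $m_5$: 16. $\Delta(e_1)=(e_1-e_2)\otimes(e_1-e_2)+e_2\otimes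 e_2$, $\Delta(e_2)=e_2\otimes e_2$, $\Delta(e_3)=e_3\otimes e_3$, $\varepsilon=(2,1,1)$. 17. $\Delta(e_1)=e_1\otimes e_1$, $\Delta(e_2)=e_1\otimes e_2+e_2\otimes e_1-e_2\otimes e_2$, $\Delta(e_3)=e_1\otimes e_3+e_3\otimes e_1-e_2\otimes e_3-e_3\otimes e_2$, $\varepsilon=(1,0,0)$. 18. $\Delta(e_1)=e_1\otimes e_1$, $\Delta(e_2)=e_1\otimes e_2+e_2\otimes e_1-e_2\otimes e_2-e_3\otimes e_3$, $\Delta(e_3)=e_1\otimes e_3-e_2\otimes e_3+e_3\otimes e_1-e_3\otimes e_2$, $\varepsilon=(1,0,0)$. 19. $\Delta(e_1)=e_1\otimes e_1$, $\Delta(e_2)=e_2\otimes e_2$, $\Delta(e_3)=e_2\otimes e_3+e_3\otimes e_2$, $\varepsilon=(1,1,0)$. 20. $\Delta(e_1)=e_1\otimes e_1$, $\Delta(e_2)=e_2\otimes e_2+e_3\otimes e_3$, $\Delta(e_3)=e_2\otimes e_3+e_3\otimes e_2$, $\varepsilon=(1,1,0)$. -/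

import Mathlib

open scoped TensorProduct

/-- The data of a quintuple `(V, m, η, Δ, ε)` on a `K`-vector space `V`. The multiplication
`m : V ⊗ V → V` is given in its curried form (a bilinear map), and the linear map `η : K → V` by the
element `η 1`. No axioms are imposed here. -/
structure WeakBialgebraData (K V : Type*) [Field K] [AddCommGroup V] [Module K V] where
  /-- the multiplication -/
  mul : V →ₗ[K] V →ₗ[K] V
  /-- the unit element -/
  one : V
  /-- the comultiplication -/
  comul : V →ₗ[K] V ⊗[K] V
  /-- the counit -/
  counit : V →ₗ[K] K

namespace WeakBialgebraData

variable {K V W : Type*} [Field K] [AddCommGroup V] [Module K V] [AddCommGroup W] [Module K W]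

/-- The multiplication `(x ⊗ y) • (x' ⊗ y') = x x' ⊗ y y'` of `V ⊗ V`. -/
noncomputable def mul₂ (B : WeakBialgebraData K V) :
    V ⊗[K] V →ₗ[K] V ⊗[K] V →ₗ[K] V ⊗[K] V :=
  TensorProduct.map₂ B.mul B.mul

/-- The multiplication
`(x ⊗ (y ⊗ z)) • (x' ⊗ (y' ⊗ z')) = x x' ⊗ (y y' ⊗ z z')` of `V ⊗ V ⊗ V`. -/
noncomputable def mul₃ (B : WeakBialgebraData K V) :
    V ⊗[K] (V ⊗[K] V) →ₗ[K] V ⊗[K] (V ⊗[K] V) →ₗ[K] V ⊗[K] (V ⊗[K] V) :=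
  TensorProduct.map₂ B.mul B.mul₂

/-- `(Δ ⊗ id)(Δ x)`, as an element of `V ⊗ (V ⊗ V)`. -/
noncomputable def comulLeft (B : WeakBialgebraData K V) (x : V) : V ⊗[K] (V ⊗[K] V) :=
  TensorProduct.assoc K V V V (B.comul.rTensor V (B.comul x))

/-- `(id ⊗ Δ)(Δ x)`. -/
noncomputable def comulRight (B : WeakBialgebraData K V) (x : V) : V ⊗[K] (V ⊗[K] V) :=
  B.comul.lTensor V (B.comul x)

/-- `Δ(1) ⊗ 1`, as an element of `V ⊗ (V ⊗ V)`. -/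
noncomputable def comulOneTmulOne (B : WeakBialgebraData K V) : V ⊗[K] (V ⊗[K] V) :=
  TensorProduct.assoc K V V V (B.comul B.one ⊗ₜ[K] B.one)

/-- `1 ⊗ Δ(1)`. -/
noncomputable def oneTmulComulOne (B : WeakBialgebraData K V) : V ⊗[K] (V ⊗[K] V) :=
  B.one ⊗ₜ[K] B.comul B.one

/-- The sum `∑ ε(x y₍₁₎) ε(y₍₂₎ z)`. -/
noncomputable def counitSplit (B : WeakBialgebraData K V) (x y z : V) : K :=
  LinearMap.mul' K K
    (TensorProduct.map (B.counit ∘ₗ B.mul x) (B.counit ∘ₗ B.mul.flip z) (B.comul y))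

/-- The axioms of a weak bialgebra. -/
structure IsWeakBialgebra (B : WeakBialgebraData K V) : Prop where
  mul_assoc : ∀ x y z, B.mul (B.mul x y) z = B.mul x (B.mul y z)
  mul_one : ∀ x, B.mul x B.one = x
  one_mul : ∀ x, B.mul B.one x = x
  coassoc : ∀ x, B.comulLeft x = B.comulRight x
  counit_left : ∀ x, TensorProduct.lid K V (B.counit.rTensor V (B.comul x)) = x
  counit_right : ∀ x, TensorProduct.rid K V (B.counit.lTensor V (B.comul x)) = x
  comul_mul : ∀ x y, B.comul (B.mul x y) = B.mul₂ (B.comul x) (B.comul y)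
  comul_one_left : B.comulLeft B.one = B.mul₃ B.comulOneTmulOne B.oneTmulComulOne
  comul_one_right : B.comulLeft B.one = B.mul₃ B.oneTmulComulOne B.comulOneTmulOne
  counit_mul : ∀ x y z, B.counit (B.mul (B.mul x y) z) = B.counitSplit x y z

/-- Two quintuples are isomorphic if some linear isomorphism transports all the structure. -/
def Isomorphic (B : WeakBialgebraData K V) (B' : WeakBialgebraData K W) : Prop :=
  ∃ g : V ≃ₗ[K] W,
    (∀ x y, g (B.mul x y) = B'.mul (g x) (g y)) ∧
    g B.one = B'.one ∧
    (∀ x, TensorProduct.map g.toLinearMap g.toLinearMap (B.comul x) = B'.comul (g x)) ∧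
    (∀ x, B'.counit (g x) = B.counit x)

end WeakBialgebraData

/-! The explicit structures on `ℂ³`, with its standard basis `e₁, e₂, e₃`. -/

namespace WeakBialgebraDimThree

/-- first standard basis vector of `ℂ³` -/
def e₁ : Fin 3 → ℂ := ![1, 0, 0]

/-- second standard basis vector of `ℂ³` -/
def e₂ : Fin 3 → ℂ := ![0, 1, 0]

/-- third standard basis vector of `ℂ³` -/
def e₃ : Fin 3 → ℂ := ![0, 0, 1]

/-- The linear map on `ℂ³` with the prescribed values at `e₁, e₂, e₃`. -/
noncomputable def lin {M : Type*} [AddCommGroup M] [Module ℂ M] (a b c : M) :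
    (Fin 3 → ℂ) →ₗ[ℂ] M :=
  (Pi.basisFun ℂ (Fin 3)).constr ℂ ![a, b, c]

/-- The bilinear multiplication on `ℂ³` with unit `e₁` and the prescribed products
`e₂ e₂ = a`, `e₂ e₃ = b`, `e₃ e₂ = c`, `e₃ e₃ = d`. -/
noncomputable def unitalMul (a b c d : Fin 3 → ℂ) :
    (Fin 3 → ℂ) →ₗ[ℂ] (Fin 3 → ℂ) →ₗ[ℂ] (Fin 3 → ℂ) :=
  lin (lin e₁ e₂ e₃) (lin e₂ a b) (lin e₃ c d)

/-- `e₂ e₂ = e₂`, `e₂ e₃ = e₃ e₂ = e₃ e₃ = e₃` -/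
noncomputable def m₁ := unitalMul e₂ e₃ e₃ e₃

/-- `e₂ e₂ = e₂`, `e₂ e₃ = e₃ e₂ = e₃`, `e₃ e₃ = 0` -/
noncomputable def m₂ := unitalMul e₂ e₃ e₃ 0

/-- `e₂ e₂ = e₂`, `e₂ e₃ = e₃`, `e₃ e₂ = e₃ e₃ = 0` -/
noncomputable def m₅ := unitalMul e₂ e₃ 0 0

/-- The quintuple on `ℂ³` with multiplication `m`, unit `e₁`, comultiplication with values
`d₁, d₂, d₃` and counit with values `c₁, c₂, c₃` at `e₁, e₂, e₃`. -/
noncomputable def quintuple (m : (Fin 3 → ℂ) →ₗ[ℂ] (Fin 3 → ℂ) →ₗ[ℂ] (Fin 3 → ℂ))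
    (d₁ d₂ d₃ : (Fin 3 → ℂ) ⊗[ℂ] (Fin 3 → ℂ)) (c₁ c₂ c₃ : ℂ) :
    WeakBialgebraData ℂ (Fin 3 → ℂ) :=
  ⟨m, e₁, lin d₁ d₂ d₃, lin c₁ c₂ c₃⟩

/-- The twenty structures; the `k`-th entry of the list has index `k - 1`. -/
noncomputable def structures : Fin 20 → WeakBialgebraData ℂ (Fin 3 → ℂ) :=
  ![ -- (1)
    quintuple m₁
      (e₁ ⊗ₜ e₁)
      (e₁ ⊗ₜ (e₁ - e₃) + e₂ ⊗ₜ (2 • e₃ - e₂) + e₃ ⊗ₜ (2 • e₂ - e₃ - e₁))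
      (e₁ ⊗ₜ (e₂ - e₃) + e₂ ⊗ₜ (e₁ - 2 • e₂ + e₃) + e₃ ⊗ₜ (e₂ + e₃ - e₁))
      1 1 1,
    -- (2)
    quintuple m₁
      (e₁ ⊗ₜ e₁)
      (e₂ ⊗ₜ e₂)
      (e₃ ⊗ₜ e₃)
      1 1 1,
    -- (3)
    quintuple m₁
      (e₁ ⊗ₜ e₁)
      (e₂ ⊗ₜ e₂)
      ((e₂ - e₃) ⊗ₜ e₃ + e₃ ⊗ₜ (e₂ - e₃))
      1 1 0,
    -- (4)
    quintuple m₁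
      (e₁ ⊗ₜ e₁)
      ((e₂ - e₃) ⊗ₜ e₃ + e₃ ⊗ₜ e₂)
      (e₃ ⊗ₜ e₃)
      1 1 1,
    -- (5)
    quintuple m₁
      (e₁ ⊗ₜ e₁)
      (e₂ ⊗ₜ e₂ + (e₁ - e₂) ⊗ₜ e₃)
      ((e₁ - e₃) ⊗ₜ e₃ + e₃ ⊗ₜ e₂)
      1 1 0,
    -- (6)
    quintuple m₁
      (e₁ ⊗ₜ e₁)
      (e₂ ⊗ₜ e₂ + e₃ ⊗ₜ (e₁ - e₂))
      (e₂ ⊗ₜ e₃ + e₃ ⊗ₜ e₁ - e₃ ⊗ₜ e₃)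
      1 1 0,
    -- (7)
    quintuple m₁
      (e₁ ⊗ₜ e₁)
      ((e₁ - e₂) ⊗ₜ (e₁ - e₂) + e₂ ⊗ₜ e₂)
      (e₃ ⊗ₜ e₃)
      1 1 1,
    -- (8)
    quintuple m₁
      ((e₁ - e₂) ⊗ₜ (e₁ - e₂) + e₂ ⊗ₜ e₂)
      (e₂ ⊗ₜ e₂)
      (e₃ ⊗ₜ e₃)
      2 1 1,
    -- (9)
    quintuple m₁
      ((e₁ - e₂) ⊗ₜ (e₁ - e₂) + e₂ ⊗ₜ e₂)
      (e₂ ⊗ₜ e₂)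
      ((e₂ - e₃) ⊗ₜ e₃ + e₃ ⊗ₜ (e₂ - e₃))
      2 1 0,
    -- (10)
    quintuple m₁
      ((e₁ - e₂) ⊗ₜ (e₁ - e₂) + (e₂ - e₃) ⊗ₜ (e₂ - e₃) + e₃ ⊗ₜ e₃)
      ((e₂ - e₃) ⊗ₜ (e₂ - e₃) + e₃ ⊗ₜ e₃)
      (e₃ ⊗ₜ e₃)
      3 2 1,
    -- (11)
    quintuple m₁
      (e₁ ⊗ₜ (e₂ - e₃) + e₃ ⊗ₜ (e₁ - 2 • e₂ + 2 • e₃))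
      ((e₂ - e₃) ⊗ₜ (e₂ - e₃) + e₃ ⊗ₜ e₃)
      (e₃ ⊗ₜ e₃)
      2 2 1,
    -- (12)
    quintuple m₂
      (e₁ ⊗ₜ e₁)
      (e₁ ⊗ₜ e₂ + e₂ ⊗ₜ e₁ - e₂ ⊗ₜ e₂)
      (e₁ ⊗ₜ e₃ + e₃ ⊗ₜ e₁ - e₃ ⊗ₜ e₂)
      1 0 0,
    -- (13)
    quintuple m₂
      (e₁ ⊗ₜ e₁)
      (e₁ ⊗ₜ e₂ + e₂ ⊗ₜ e₁ - e₂ ⊗ₜ e₂)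
      (e₁ ⊗ₜ e₃ - e₂ ⊗ₜ e₃ + e₃ ⊗ₜ e₁ - e₃ ⊗ₜ e₂ + e₃ ⊗ₜ e₃)
      1 0 0,
    -- (14)
    quintuple m₂
      (e₁ ⊗ₜ e₁)
      (e₁ ⊗ₜ e₂ + e₂ ⊗ₜ e₁ - e₂ ⊗ₜ e₂)
      (e₁ ⊗ₜ e₃ - e₂ ⊗ₜ e₃ + e₃ ⊗ₜ e₁)
      1 0 0,
    -- (15)
    quintuple m₂
      (e₁ ⊗ₜ e₁)
      (e₁ ⊗ₜ e₂ + e₂ ⊗ₜ e₁ - e₂ ⊗ₜ e₂)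
      (e₁ ⊗ₜ e₃ - e₃ ⊗ₜ e₂ + e₃ ⊗ₜ e₁ - e₂ ⊗ₜ e₃)
      1 0 0,
    -- (16)
    quintuple m₅
      ((e₁ - e₂) ⊗ₜ (e₁ - e₂) + e₂ ⊗ₜ e₂)
      (e₂ ⊗ₜ e₂)
      (e₃ ⊗ₜ e₃)
      2 1 1,
    -- (17)
    quintuple m₅
      (e₁ ⊗ₜ e₁)
      (e₁ ⊗ₜ e₂ + e₂ ⊗ₜ e₁ - e₂ ⊗ₜ e₂)
      (e₁ ⊗ₜ e₃ + e₃ ⊗ₜ e₁ - e₂ ⊗ₜ e₃ - e₃ ⊗ₜ e₂)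
      1 0 0,
    -- (18)
    quintuple m₅
      (e₁ ⊗ₜ e₁)
      (e₁ ⊗ₜ e₂ + e₂ ⊗ₜ e₁ - e₂ ⊗ₜ e₂ - e₃ ⊗ₜ e₃)
      (e₁ ⊗ₜ e₃ - e₂ ⊗ₜ e₃ + e₃ ⊗ₜ e₁ - e₃ ⊗ₜ e₂)
      1 0 0,
    -- (19)
    quintuple m₅
      (e₁ ⊗ₜ e₁)
      (e₂ ⊗ₜ e₂)
      (e₂ ⊗ₜ e₃ + e₃ ⊗ₜ e₂)
      1 1 0,
    -- (20)
    quintuple m₅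
      (e₁ ⊗ₜ e₁)
      (e₂ ⊗ₜ e₂ + e₃ ⊗ₜ e₃)
      (e₂ ⊗ₜ e₃ + e₃ ⊗ₜ e₂)
      1 1 0]

end WeakBialgebraDimThree

/-! Two weak bialgebras with the same structure constants in some bases are isomorphic, so
classifying means choosing good bases. A three-dimensional algebra over an algebraically closed
field of characteristic zero falls under one of two cases (`AlgebraDimThree.isStandard`). Either one
element generates it, and it is K[X] modulo a cubic: K³, K × K[x]/(x²) or K[x]/(x³), depending on
the multiplicities of the roots. Or every element is quadratic, and it is the local algebra whose
radical has square zero, or the algebra of triangular 2 × 2 matrices.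

The two local algebras carry no weak bialgebra structure: Δ(1) is a nonzero idempotent of a local
algebra, hence 1 ⊗ 1, and comparing coefficients then gives 3 = 0 (`not_isCompatible_mulLocal`).

On K³ the images Δ(p_k) of the primitive idempotents are orthogonal idempotents of K⁹. So Δ is dual
to a partial multiplication on three elements, and the other axioms make it a category with three
morphisms whose identities are marked by ε (`isCategory_of_isCompatible`). A finite check finds
eleven such categories.

On K × K[x]/(x²) and on triangular matrices the equations for Δ and ε are solved by hand (`eq_dual`,
`eq_arrow`, `eq_triangular`), and algebra automorphisms normalise the remaining parameters, leaving
four and five structures.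

Conversely, in adapted bases the twenty structures have integer constants, so their axioms can be
evaluated over ℤ and carried to ℂ. -/

/-! ### Structure constants and isomorphism. -/

/-- Structure constants of a quintuple with respect to a basis indexed by `Fin 3`: the constants
`m i j k` of the multiplication, `d i j k` of the comultiplication, and the coordinates `u i` of the
unit and `e i` of the counit. -/
structure StructureConstants (R : Type*) where
  m : Fin 3 → Fin 3 → Fin 3 → R
  u : Fin 3 → R
  d : Fin 3 → Fin 3 → Fin 3 → R
  e : Fin 3 → R

namespace StructureConstants

/-- The axioms of an algebra in terms of structure constants. -/
structure IsAlgebra {R : Type*} [CommRing R] (T : StructureConstants R) : Prop where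
  mul_assoc : ∀ i j k l, ∑ a, T.m i j a * T.m a k l = ∑ a, T.m j k a * T.m i a l
  mul_one : ∀ i k, ∑ a, T.u a * T.m i a k = if i = k then 1 else 0
  one_mul : ∀ i k, ∑ a, T.u a * T.m a i k = if i = k then 1 else 0

/-- The coordinates of `Δ(1)`. -/
def comulOne {R : Type*} [CommRing R] (T : StructureConstants R) (p q : Fin 3) : R :=
  ∑ a, T.u a * T.d a p q

/-- The axioms of a weak bialgebra which involve `Δ` or `ε`, in terms of structure constants. -/
structure IsCompatible {R : Type*} [CommRing R] (T : StructureConstants R) : Prop where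
  coassoc : ∀ i p q r, ∑ a, T.d i a r * T.d a p q = ∑ a, T.d i p a * T.d a q r
  counit_left : ∀ i k, ∑ a, T.e a * T.d i a k = if i = k then 1 else 0
  counit_right : ∀ i k, ∑ a, T.e a * T.d i k a = if i = k then 1 else 0
  comul_mul : ∀ i j p q, ∑ a, T.m i j a * T.d a p q =
    ∑ a, ∑ b, ∑ c, ∑ f, T.d i a b * T.d j c f * (T.m a c p * T.m b f q)
  comul_one_left : ∀ p q r, ∑ a, T.comulOne a r * T.d a p q =
    ∑ a, ∑ b, T.comulOne p a * T.comulOne b r * T.m a b q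
  comul_one_right : ∀ p q r, ∑ a, T.comulOne a r * T.d a p q =
    ∑ a, ∑ b, T.comulOne p a * T.comulOne b r * T.m b a q
  counit_mul : ∀ i j k, ∑ a, ∑ b, T.m i j a * T.m a k b * T.e b =
    ∑ a, ∑ b, T.d j a b * ((∑ c, T.m i a c * T.e c) * (∑ c, T.m b k c * T.e c))

end StructureConstants

namespace WeakBialgebraData

variable {K V W : Type*} [Field K] [AddCommGroup V] [Module K V] [AddCommGroup W] [Module K W]

/-- `B` has structure constants `T` with respect to the basis `b`. -/
structure HasConstants (B : WeakBialgebraData K V) (b : Module.Basis (Fin 3) K V)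
    (T : StructureConstants K) : Prop where
  mul : ∀ i j, B.mul (b i) (b j) = ∑ k, T.m i j k • b k
  one : B.one = ∑ k, T.u k • b k
  comul : ∀ i, B.comul (b i) = ∑ j, ∑ k, T.d i j k • (b j ⊗ₜ[K] b k)
  counit : ∀ i, B.counit (b i) = T.e i

/-- Applied once the algebra has been put in normal form: `m` and `u` are then known tables, and
only Δ and ε remain unknown. -/
theorem exists_hasConstants (B : WeakBialgebraData K V) (b : Module.Basis (Fin 3) K V)
    (m : Fin 3 → Fin 3 → Fin 3 → K) (u : Fin 3 → K)
    (hm : ∀ i j, B.mul (b i) (b j) = ∑ k, m i j k • b k) (hu : B.one = ∑ k, u k • b k) :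
    ∃ d e, B.HasConstants b ⟨m, u, d, e⟩ := by
  refine ⟨fun i j k => (b.tensorProduct b).repr (B.comul (b i)) (j, k), fun i => B.counit (b i),
    hm, hu, fun i => ?_, fun i => rfl⟩
  conv_lhs => rw [← (b.tensorProduct b).sum_repr (B.comul (b i))]
  rw [Fintype.sum_prod_type]
  simp [Module.Basis.tensorProduct_apply]

/-- The linear map matching the two bases does it. Every isomorphism in the classification arises in
this way. -/
theorem HasConstants.isomorphic {B : WeakBialgebraData K V} {B' : WeakBialgebraData K W}
    {b : Module.Basis (Fin 3) K V} {b' : Module.Basis (Fin 3) K W} {T : StructureConstants K}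
    (h : B.HasConstants b T) (h' : B'.HasConstants b' T) : B.Isomorphic B' := by
  have hg : ∀ i, b.equiv b' (Equiv.refl _) (b i) = b' i := fun i => by simp
  refine ⟨b.equiv b' (Equiv.refl _), ?_, ?_, ?_, ?_⟩
  · have : B.mul.compr₂ (b.equiv b' (Equiv.refl _)).toLinearMap =
        B'.mul.compl₁₂ (b.equiv b' (Equiv.refl _)).toLinearMap
          (b.equiv b' (Equiv.refl _)).toLinearMap := by
      refine LinearMap.ext_basis b b fun i j => ?_
      simp [h.mul, h'.mul, map_sum]
    exact fun x y => LinearMap.congr_fun₂ this x y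
  · simp [h.one, h'.one, map_sum]
  · have : TensorProduct.map (b.equiv b' (Equiv.refl _)).toLinearMap
        (b.equiv b' (Equiv.refl _)).toLinearMap ∘ₗ B.comul =
        B'.comul ∘ₗ (b.equiv b' (Equiv.refl _)).toLinearMap := by
      refine b.ext fun i => ?_
      simp [h.comul, h'.comul, map_sum]
    exact fun x => LinearMap.congr_fun this x
  · have : B'.counit ∘ₗ (b.equiv b' (Equiv.refl _)).toLinearMap = B.counit := by
      refine b.ext fun i => ?_
      simp [h.counit, h'.counit]
    exact fun x => LinearMap.congr_fun this x

end WeakBialgebraData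

/-! ### The axioms are equivalent to polynomial identities in the structure constants. -/

namespace WeakBialgebraData

variable {K V W : Type*} [Field K] [AddCommGroup V] [Module K V] [AddCommGroup W] [Module K W]

theorem repr_assoc_tmul (b : Module.Basis (Fin 3) K V) (t : V ⊗[K] V) (v : V) (p q r : Fin 3) :
    (b.tensorProduct (b.tensorProduct b)).repr (TensorProduct.assoc K V V V (t ⊗ₜ v)) (p, q, r) =
      (b.tensorProduct b).repr t (p, q) * b.repr v r := by
  induction t using TensorProduct.induction_on with
  | zero => simp
  | tmul x y => simp; ring
  | add s t hs ht => simp [TensorProduct.add_tmul, hs, ht, add_mul]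

theorem counitSplit_add_left (B : WeakBialgebraData K V) (x x' y z : V) :
    B.counitSplit (x + x') y z = B.counitSplit x y z + B.counitSplit x' y z := by
  simp [counitSplit, LinearMap.comp_add, TensorProduct.map_add_left]

theorem counitSplit_smul_left (B : WeakBialgebraData K V) (c : K) (x y z : V) :
    B.counitSplit (c • x) y z = c * B.counitSplit x y z := by
  simp [counitSplit, LinearMap.comp_smul, TensorProduct.map_smul_left]

theorem counitSplit_add_middle (B : WeakBialgebraData K V) (x y y' z : V) :
    B.counitSplit x (y + y') z = B.counitSplit x y z + B.counitSplit x y' z := by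
  simp [counitSplit]

theorem counitSplit_smul_middle (B : WeakBialgebraData K V) (c : K) (x y z : V) :
    B.counitSplit x (c • y) z = c * B.counitSplit x y z := by
  simp [counitSplit]

theorem counitSplit_add_right (B : WeakBialgebraData K V) (x y z z' : V) :
    B.counitSplit x y (z + z') = B.counitSplit x y z + B.counitSplit x y z' := by
  simp [counitSplit, LinearMap.comp_add, TensorProduct.map_add_right]

theorem counitSplit_smul_right (B : WeakBialgebraData K V) (c : K) (x y z : V) :
    B.counitSplit x y (c • z) = c * B.counitSplit x y z := by
  simp [counitSplit, LinearMap.comp_smul, TensorProduct.map_smul_right]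

namespace HasConstants

variable {B : WeakBialgebraData K V} {b : Module.Basis (Fin 3) K V} {T : StructureConstants K}

theorem repr_comul (h : B.HasConstants b T) (i p q : Fin 3) :
    (b.tensorProduct b).repr (B.comul (b i)) (p, q) = T.d i p q := by
  simp [h.comul, Finsupp.single_apply]

theorem repr_comulLeft (h : B.HasConstants b T) (i p q r : Fin 3) :
    (b.tensorProduct (b.tensorProduct b)).repr (B.comulLeft (b i)) (p, q, r) =
      ∑ a, T.d i a r * T.d a p q := by
  rw [comulLeft, h.comul]
  simp [repr_assoc_tmul, h.repr_comul, map_sum, Finsupp.single_apply]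

theorem repr_comulRight (h : B.HasConstants b T) (i p q r : Fin 3) :
    (b.tensorProduct (b.tensorProduct b)).repr (B.comulRight (b i)) (p, q, r) =
      ∑ a, T.d i p a * T.d a q r := by
  rw [comulRight, h.comul]
  simp [h.repr_comul, map_sum, Finsupp.single_apply]

theorem comul_one (h : B.HasConstants b T) :
    B.comul B.one = ∑ j, ∑ k, T.comulOne j k • (b j ⊗ₜ[K] b k) := by
  apply (b.tensorProduct b).repr.injective
  ext ⟨p, q⟩
  simp [h.one, h.comul, map_sum, Finsupp.single_apply, StructureConstants.comulOne]

theorem repr_comulLeft_one (h : B.HasConstants b T) (p q r : Fin 3) :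
    (b.tensorProduct (b.tensorProduct b)).repr (B.comulLeft B.one) (p, q, r) =
      ∑ a, T.comulOne a r * T.d a p q := by
  rw [comulLeft, h.comul_one]
  simp [repr_assoc_tmul, h.repr_comul, map_sum, Finsupp.single_apply]

theorem repr_mul (h : B.HasConstants b T) (x y : V) (p : Fin 3) :
    b.repr (B.mul x y) p = ∑ a, ∑ c, b.repr x a * b.repr y c * T.m a c p := by
  conv_lhs => rw [← b.sum_repr x, ← b.sum_repr y]
  simp only [map_sum, map_smul, LinearMap.sum_apply, LinearMap.smul_apply, h.mul,
    Finsupp.coe_finsetSum, Finset.sum_apply, Finsupp.smul_apply, smul_eq_mul,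
    Module.Basis.repr_self, Finsupp.single_apply]
  rw [Finset.sum_comm]
  simp [Finset.mul_sum, mul_assoc, mul_left_comm]

theorem repr_mul₂ (h : B.HasConstants b T) (s t : V ⊗[K] V) (p q : Fin 3) :
    (b.tensorProduct b).repr (B.mul₂ s t) (p, q) =
      ∑ a, ∑ c, ∑ f, ∑ g, (b.tensorProduct b).repr s (a, c) * (b.tensorProduct b).repr t (f, g) *
        (T.m a f p * T.m c g q) := by
  induction s using TensorProduct.induction_on with
  | zero => simp
  | add s s' hs hs' => simp [hs, hs', add_mul, Finset.sum_add_distrib]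
  | tmul x y =>
    induction t using TensorProduct.induction_on with
    | zero => simp
    | add s s' hs hs' => simp only [map_add, Finsupp.add_apply, hs, hs', add_mul, mul_add,
        Finset.sum_add_distrib]
    | tmul z w =>
      simp only [mul₂, TensorProduct.map₂_apply_tmul, TensorProduct.map_tmul,
        Module.Basis.tensorProduct_repr_tmul_apply, h.repr_mul, smul_eq_mul, Fin.sum_univ_three]
      ring

/-- The outer tensor legs are multiplied by the unit only, which is why the unit laws are needed and
why a single constant `T.m`, for the middle leg, survives. -/
theorem repr_mul₃_left (h : B.HasConstants b T) (h₁ : ∀ x, B.mul x B.one = x)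
    (h₂ : ∀ x, B.mul B.one x = x) (p q r : Fin 3) :
    (b.tensorProduct (b.tensorProduct b)).repr
      (B.mul₃ B.comulOneTmulOne B.oneTmulComulOne) (p, q, r) =
      ∑ a, ∑ c, T.comulOne p a * T.comulOne c r * T.m a c q := by
  rw [comulOneTmulOne, oneTmulComulOne, h.comul_one]
  simp only [TensorProduct.sum_tmul, TensorProduct.tmul_sum, ← TensorProduct.smul_tmul',
    TensorProduct.tmul_smul, map_sum, map_smul, TensorProduct.assoc_tmul, LinearMap.sum_apply,
    LinearMap.smul_apply, mul₃, mul₂, TensorProduct.map₂_apply_tmul, TensorProduct.map_tmul, h₁, h₂,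
    h.mul,
    Finsupp.coe_finsetSum, Finset.sum_apply, Finsupp.smul_apply, smul_eq_mul,
    Module.Basis.tensorProduct_repr_tmul_apply, Module.Basis.repr_self, Finsupp.single_apply]
  simp [Finset.mul_sum, mul_assoc]
  rw [Finset.sum_comm]
  simp [mul_left_comm]

theorem repr_mul₃_right (h : B.HasConstants b T) (h₁ : ∀ x, B.mul x B.one = x)
    (h₂ : ∀ x, B.mul B.one x = x) (p q r : Fin 3) :
    (b.tensorProduct (b.tensorProduct b)).repr
      (B.mul₃ B.oneTmulComulOne B.comulOneTmulOne) (p, q, r) =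
      ∑ a, ∑ c, T.comulOne p a * T.comulOne c r * T.m c a q := by
  rw [comulOneTmulOne, oneTmulComulOne, h.comul_one]
  simp only [TensorProduct.sum_tmul, TensorProduct.tmul_sum, ← TensorProduct.smul_tmul',
    TensorProduct.tmul_smul, map_sum, map_smul, TensorProduct.assoc_tmul, LinearMap.sum_apply,
    LinearMap.smul_apply, mul₃, mul₂, TensorProduct.map₂_apply_tmul, TensorProduct.map_tmul, h₁, h₂,
    h.mul,
    Finsupp.coe_finsetSum, Finset.sum_apply, Finsupp.smul_apply, smul_eq_mul,
    Module.Basis.tensorProduct_repr_tmul_apply, Module.Basis.repr_self, Finsupp.single_apply]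
  simp [Finset.mul_sum, mul_assoc]

theorem counit_mul_mul (h : B.HasConstants b T) (i j k : Fin 3) :
    B.counit (B.mul (B.mul (b i) (b j)) (b k)) = ∑ a, ∑ c, T.m i j a * T.m a k c * T.e c := by
  simp [h.mul, h.counit, Finset.mul_sum, mul_assoc]

theorem counitSplit (h : B.HasConstants b T) (i j k : Fin 3) :
    B.counitSplit (b i) (b j) (b k) =
      ∑ a, ∑ c, T.d j a c * ((∑ f, T.m i a f * T.e f) * (∑ f, T.m c k f * T.e f)) := by
  simp [WeakBialgebraData.counitSplit, h.comul, h.mul, h.counit]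

/-- Coordinates of the axioms at basis vectors. This direction drives the classification;
`isWeakBialgebra` is the converse, used to verify the twenty structures. -/
theorem isCompatible (h : B.HasConstants b T) (hB : B.IsWeakBialgebra) : T.IsCompatible where
  coassoc i p q r := by
    rw [← h.repr_comulLeft, hB.coassoc, h.repr_comulRight]
  counit_left i k := by
    have := congrArg (fun x => b.repr x k) (hB.counit_left (b i))
    simpa [h.comul, h.counit, Finsupp.single_apply, mul_comm] using this
  counit_right i k := by
    have := congrArg (fun x => b.repr x k) (hB.counit_right (b i))
    simpa [h.comul, h.counit, Finsupp.single_apply, mul_comm] using this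
  comul_mul i j p q := by
    have := congrArg (fun x => (b.tensorProduct b).repr x (p, q)) (hB.comul_mul (b i) (b j))
    simpa only [h.repr_mul₂, h.repr_comul, h.mul, map_sum, map_smul, Finsupp.coe_finsetSum,
      Finset.sum_apply, Finsupp.smul_apply, smul_eq_mul] using this
  comul_one_left p q r := by
    rw [← h.repr_comulLeft_one, hB.comul_one_left, h.repr_mul₃_left hB.mul_one hB.one_mul]
  comul_one_right p q r := by
    rw [← h.repr_comulLeft_one, hB.comul_one_right, h.repr_mul₃_right hB.mul_one hB.one_mul]
  counit_mul i j k := by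
    rw [← h.counit_mul_mul, hB.counit_mul, h.counitSplit]

theorem mul_assoc (h : B.HasConstants b T) (hA : T.IsAlgebra) (x y z : V) :
    B.mul (B.mul x y) z = B.mul x (B.mul y z) := by
  have h₁ : ∀ i j z, B.mul (B.mul (b i) (b j)) z = B.mul (b i) (B.mul (b j) z) := by
    intro i j z
    have : B.mul (B.mul (b i) (b j)) = B.mul (b i) ∘ₗ B.mul (b j) := b.ext fun k =>
      b.repr.injective <| by
        ext l
        simpa [h.mul, Finsupp.single_apply] using hA.mul_assoc i j k l
    exact LinearMap.congr_fun this z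
  have h₂ : ∀ i y z, B.mul (B.mul (b i) y) z = B.mul (b i) (B.mul y z) := by
    intro i y z
    have : B.mul.flip z ∘ₗ B.mul (b i) = B.mul (b i) ∘ₗ B.mul.flip z :=
      b.ext fun j => h₁ i j z
    exact LinearMap.congr_fun this y
  have : B.mul.flip z ∘ₗ B.mul.flip y = B.mul.flip (B.mul y z) := b.ext fun i => h₂ i y z
  exact LinearMap.congr_fun this x

theorem counit_mul (h : B.HasConstants b T) (hC : T.IsCompatible) (x y z : V) :
    B.counit (B.mul (B.mul x y) z) = B.counitSplit x y z := by
  -- Linear induction over the basis; the zero vector is covered by scaling a basis vector by 0.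
  have key : ∀ P : V → Prop, (∀ i, P (b i)) → (∀ v w, P v → P w → P (v + w)) →
      (∀ (c : K) v, P v → P (c • v)) → ∀ v, P v := fun P h₁ h₂ h₃ v =>
    Submodule.span_induction (p := fun v _ => P v) (by rintro _ ⟨i, rfl⟩; exact h₁ i)
      (by simpa using h₃ 0 _ (h₁ 0)) (fun v w _ _ => h₂ v w) (fun c v _ => h₃ c v) (b.mem_span v)
  refine key (fun x => ∀ y z, B.counit (B.mul (B.mul x y) z) = B.counitSplit x y z) (fun i y z => ?_)
    (fun v w hv hw y z => ?_) (fun c v hv y z => ?_) x y z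
  · refine key (fun y => ∀ z, B.counit (B.mul (B.mul (b i) y) z) = B.counitSplit (b i) y z)
      (fun j z => ?_) (fun v w hv hw z => ?_) (fun c v hv z => ?_) y z
    · refine key (fun z => B.counit (B.mul (B.mul (b i) (b j)) z) = B.counitSplit (b i) (b j) z)
        (fun k => ?_) (fun v w hv hw => ?_) (fun c v hv => ?_) z
      · rw [h.counit_mul_mul, hC.counit_mul, h.counitSplit]
      · simp [counitSplit_add_right, hv, hw]
      · simp [counitSplit_smul_right, hv]
    · simp [counitSplit_add_middle, hv, hw]
    · simp [counitSplit_smul_middle, hv]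
  · simp [counitSplit_add_left, hv, hw]
  · simp [counitSplit_smul_left, hv]

theorem isWeakBialgebra (h : B.HasConstants b T) (hA : T.IsAlgebra) (hC : T.IsCompatible) :
    B.IsWeakBialgebra := by
  have h₁ : ∀ x, B.mul x B.one = x := fun x => by
    have : B.mul.flip B.one = LinearMap.id := b.ext fun i => b.repr.injective <| by
      ext k
      simpa [h.one, h.mul, Finsupp.single_apply] using hA.mul_one i k
    exact LinearMap.congr_fun this x
  have h₂ : ∀ x, B.mul B.one x = x := fun x => by
    have : B.mul B.one = LinearMap.id := b.ext fun i => b.repr.injective <| by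
      ext k
      simpa [h.one, h.mul, Finsupp.single_apply] using hA.one_mul i k
    exact LinearMap.congr_fun this x
  refine ⟨fun x y z => ?_, h₁, h₂, fun x => ?_, fun x => ?_, fun x => ?_, fun x y => ?_, ?_, ?_,
    fun x y z => ?_⟩
  · exact h.mul_assoc hA x y z
  · have : (TensorProduct.assoc K V V V).toLinearMap ∘ₗ B.comul.rTensor V ∘ₗ B.comul =
        B.comul.lTensor V ∘ₗ B.comul := b.ext fun i => by
      apply (b.tensorProduct (b.tensorProduct b)).repr.injective
      ext ⟨p, q, r⟩
      exact (h.repr_comulLeft i p q r).trans ((hC.coassoc i p q r).trans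
        (h.repr_comulRight i p q r).symm)
    exact LinearMap.congr_fun this x
  · have : (TensorProduct.lid K V).toLinearMap ∘ₗ B.counit.rTensor V ∘ₗ B.comul =
        LinearMap.id := b.ext fun i => b.repr.injective <| by
      ext k
      simpa [h.comul, h.counit, Finsupp.single_apply, mul_comm] using hC.counit_left i k
    exact LinearMap.congr_fun this x
  · have : (TensorProduct.rid K V).toLinearMap ∘ₗ B.counit.lTensor V ∘ₗ B.comul =
        LinearMap.id := b.ext fun i => b.repr.injective <| by
      ext k
      simpa [h.comul, h.counit, Finsupp.single_apply, mul_comm] using hC.counit_right i k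
    exact LinearMap.congr_fun this x
  · have : B.mul.compr₂ B.comul = B.mul₂.compl₁₂ B.comul B.comul := by
      refine LinearMap.ext_basis b b fun i j => (b.tensorProduct b).repr.injective ?_
      ext ⟨p, q⟩
      simpa only [LinearMap.compr₂_apply, LinearMap.compl₁₂_apply, h.repr_mul₂, h.repr_comul, h.mul,
        map_sum, map_smul, Finsupp.coe_finsetSum,
        Finset.sum_apply, Finsupp.smul_apply, smul_eq_mul] using hC.comul_mul i j p q
    exact LinearMap.congr_fun₂ this x y
  · apply (b.tensorProduct (b.tensorProduct b)).repr.injective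
    ext ⟨p, q, r⟩
    rw [h.repr_comulLeft_one, hC.comul_one_left, h.repr_mul₃_left h₁ h₂]
  · apply (b.tensorProduct (b.tensorProduct b)).repr.injective
    ext ⟨p, q, r⟩
    rw [h.repr_comulLeft_one, hC.comul_one_right, h.repr_mul₃_right h₁ h₂]
  · exact h.counit_mul hC x y z

end HasConstants
end WeakBialgebraData

/-! ### Normal forms of the tables. -/

namespace StructureConstants

/-- Multiplication constants of `K³` with respect to its primitive idempotents. -/
def mulDiag (R : Type*) [CommRing R] (i j k : Fin 3) : R := if i = j ∧ j = k then 1 else 0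

/-- Multiplication constants of `K × K[x]/(x²)` with respect to the primitive idempotents
`(1, 0)`, `(0, 1)` and the nilpotent element `(0, x)`. -/
def mulDual (R : Type*) [CommRing R] : Fin 3 → Fin 3 → Fin 3 → R :=
  ![![![1, 0, 0], ![0, 0, 0], ![0, 0, 0]],
    ![![0, 0, 0], ![0, 1, 0], ![0, 0, 1]],
    ![![0, 0, 0], ![0, 0, 1], ![0, 0, 0]]]

/-- Multiplication constants of the triangular `2 × 2` matrices with respect to orthogonal
idempotents `p`, `q` and an element `x = q x p`. -/
def mulTriangular (R : Type*) [CommRing R] : Fin 3 → Fin 3 → Fin 3 → R :=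
  ![![![1, 0, 0], ![0, 0, 0], ![0, 0, 0]],
    ![![0, 0, 0], ![0, 1, 0], ![0, 0, 1]],
    ![![0, 0, 1], ![0, 0, 0], ![0, 0, 0]]]

/-- The functions on a partial magma `μ` with three elements, with counit `e`. -/
def functions (R : Type*) [CommRing R] (μ : Fin 3 → Fin 3 → Option (Fin 3)) (e : Fin 3 → R) :
    StructureConstants R where
  m := mulDiag R
  u := 1
  d k i j := if μ i j = some k then 1 else 0
  e := e

/-- Bialgebra constants on `K × K[x]/(x²)`, where `l`, `r` and `c` are the coefficients of
`q ⊗ x`, `x ⊗ q` and `x ⊗ x` in `Δ(x)`. -/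
def dual {R : Type*} [CommRing R] (l r c : R) : StructureConstants R where
  m := mulDual R
  u := ![1, 1, 0]
  d := ![![![1, 0, 0], ![0, 0, 0], ![0, 0, 0]],
    ![![0, 1, 0], ![1, 1, 0], ![0, 0, 0]],
    ![![0, 0, 1], ![0, 0, l], ![1, r, c]]]
  e := ![1, 0, 0]

/-- The category algebra of an arrow between two objects. -/
def arrow (R : Type*) [CommRing R] : StructureConstants R where
  m := mulTriangular R
  u := ![1, 1, 0]
  d := ![![![1, 0, 0], ![0, 0, 0], ![0, 0, 0]],
    ![![0, 0, 0], ![0, 1, 0], ![0, 0, 0]],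
    ![![0, 0, 0], ![0, 0, 0], ![0, 0, 1]]]
  e := ![1, 1, 1]

/-- Bialgebra constants on triangular matrices with `Δ(p) = p ⊗ p - y • (x ⊗ x)`,
`Δ(x) = p ⊗ x + x ⊗ p + c • (x ⊗ x)` and `ε(p) = 1`. -/
def triangularLeft {R : Type*} [CommRing R] (y c : R) : StructureConstants R where
  m := mulTriangular R
  u := ![1, 1, 0]
  d := ![![![1, 0, 0], ![0, 0, 0], ![0, 0, -y]],
    ![![0, 1, 0], ![1, 1, 0], ![0, 0, y]],
    ![![0, 0, 1], ![0, 0, 0], ![1, 0, c]]]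
  e := ![1, 0, 0]

/-- Bialgebra constants on triangular matrices with `Δ(q) = q ⊗ q + y • (x ⊗ x)`,
`Δ(x) = q ⊗ x + x ⊗ q + c • (x ⊗ x)` and `ε(q) = 1`. -/
def triangularRight {R : Type*} [CommRing R] (y c : R) : StructureConstants R where
  m := mulTriangular R
  u := ![1, 1, 0]
  d := ![![![1, 1, 0], ![1, 0, 0], ![0, 0, -y]],
    ![![0, 0, 0], ![0, 1, 0], ![0, 0, y]],
    ![![0, 0, 0], ![0, 0, 1], ![0, 1, c]]]
  e := ![0, 1, 0]

end StructureConstants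

/-! ### The twenty structures in bases adapted to their algebras. -/

namespace WeakBialgebraDimThree
open StructureConstants

variable {M : Type*} [AddCommGroup M] [Module ℂ M]

theorem lin_e₁ (a b c : M) : lin a b c e₁ = a := by
  have : e₁ = Pi.basisFun ℂ (Fin 3) 0 := by
    ext i; fin_cases i <;> simp [e₁]
  rw [lin, this, Module.Basis.constr_basis]; rfl

theorem lin_e₂ (a b c : M) : lin a b c e₂ = b := by
  have : e₂ = Pi.basisFun ℂ (Fin 3) 1 := by
    ext i; fin_cases i <;> simp [e₂]
  rw [lin, this, Module.Basis.constr_basis]; rfl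

theorem lin_e₃ (a b c : M) : lin a b c e₃ = c := by
  have : e₃ = Pi.basisFun ℂ (Fin 3) 2 := by
    ext i; fin_cases i <;> simp [e₃]
  rw [lin, this, Module.Basis.constr_basis]; rfl

theorem linearIndependent_idempotents : LinearIndependent ℂ ![e₁ - e₂, e₂ - e₃, e₃] := by
  rw [Fintype.linearIndependent_iff]
  intro g hg
  have h0 := congrFun hg 0
  have h1 := congrFun hg 1
  have h2 := congrFun hg 2
  simp [Fin.sum_univ_three, e₁, e₂, e₃] at h0 h1 h2
  intro i
  fin_cases i <;> simp <;> grind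

theorem linearIndependent_triangular : LinearIndependent ℂ ![e₁ - e₂, e₂, e₃] := by
  rw [Fintype.linearIndependent_iff]
  intro g hg
  have h0 := congrFun hg 0
  have h1 := congrFun hg 1
  have h2 := congrFun hg 2
  simp [Fin.sum_univ_three, e₁, e₂, e₃] at h0 h1 h2
  intro i
  fin_cases i <;> simp <;> grind

/-- The basis `e₁ - e₂, e₂ - e₃, e₃`. -/
noncomputable def basisIdem : Module.Basis (Fin 3) ℂ (Fin 3 → ℂ) :=
  basisOfLinearIndependentOfCardEqFinrank linearIndependent_idempotents (by simp)

/-- The basis `e₁ - e₂, e₂, e₃`. -/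
noncomputable def basisTri : Module.Basis (Fin 3) ℂ (Fin 3 → ℂ) :=
  basisOfLinearIndependentOfCardEqFinrank linearIndependent_triangular (by simp)

theorem coe_basisIdem : ⇑basisIdem = ![e₁ - e₂, e₂ - e₃, e₃] := by simp [basisIdem]

theorem coe_basisTri : ⇑basisTri = ![e₁ - e₂, e₂, e₃] := by simp [basisTri]

theorem m₁_basisIdem (i j : Fin 3) :
    m₁ (basisIdem i) (basisIdem j) = ∑ k, mulDiag ℂ i j k • basisIdem k := by
  rw [coe_basisIdem]
  fin_cases i <;> fin_cases j <;>
    simp [m₁, unitalMul, lin_e₁, lin_e₂, lin_e₃, Fin.sum_univ_three, mulDiag]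

theorem m₂_basisTri (i j : Fin 3) :
    m₂ (basisTri i) (basisTri j) = ∑ k, mulDual ℂ i j k • basisTri k := by
  rw [coe_basisTri]
  fin_cases i <;> fin_cases j <;>
    simp [m₂, unitalMul, lin_e₁, lin_e₂, lin_e₃, Fin.sum_univ_three, mulDual]

theorem m₅_basisTri (i j : Fin 3) :
    m₅ (basisTri i) (basisTri j) = ∑ k, mulTriangular ℂ i j k • basisTri k := by
  rw [coe_basisTri]
  fin_cases i <;> fin_cases j <;>
    simp [m₅, unitalMul, lin_e₁, lin_e₂, lin_e₃, Fin.sum_univ_three, mulTriangular]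

theorem one_basisIdem : e₁ = ∑ k, (1 : Fin 3 → ℂ) k • basisIdem k := by
  simp [coe_basisIdem, Fin.sum_univ_three]

theorem one_basisTri : e₁ = ∑ k, (![1, 1, 0] : Fin 3 → ℂ) k • basisTri k := by
  simp [coe_basisTri, Fin.sum_univ_three]

/-- In `hd` the three idempotents are replaced by arbitrary vectors `x`, `y`, `z`. The tensor
identities then follow from bilinearity alone, and the coordinates of the vectors in ℂ³ never get
unfolded. -/
theorem hasConstants_functions {d₁ d₂ d₃ : (Fin 3 → ℂ) ⊗[ℂ] (Fin 3 → ℂ)} {c₁ c₂ c₃ : ℂ}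
    {μ : Fin 3 → Fin 3 → Option (Fin 3)} {e : Fin 3 → ℂ}
    (hd : ∀ x y z : Fin 3 → ℂ, e₁ = x + y + z → e₂ = y + z → e₃ = z →
      ∀ i, ![d₁ - d₂, d₂ - d₃, d₃] i =
        ∑ j, ∑ k, (if μ j k = some i then 1 else 0 : ℂ) • (![x, y, z] j ⊗ₜ ![x, y, z] k))
    (he : ∀ i, ![c₁ - c₂, c₂ - c₃, c₃] i = e i) :
    (quintuple m₁ d₁ d₂ d₃ c₁ c₂ c₃).HasConstants basisIdem (functions ℂ μ e) where
  mul := m₁_basisIdem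
  one := one_basisIdem
  comul i := by
    have := hd (e₁ - e₂) (e₂ - e₃) e₃ (by abel) (by abel) rfl i
    rw [coe_basisIdem]
    refine Eq.trans ?_ this
    fin_cases i <;> simp [quintuple, lin_e₁, lin_e₂, lin_e₃]
  counit i := by
    refine Eq.trans ?_ (he i)
    rw [coe_basisIdem]
    fin_cases i <;> simp [quintuple, lin_e₁, lin_e₂, lin_e₃]

theorem hasConstants_tri {d₁ d₂ d₃ : (Fin 3 → ℂ) ⊗[ℂ] (Fin 3 → ℂ)} {c₁ c₂ c₃ : ℂ}
    {m : (Fin 3 → ℂ) →ₗ[ℂ] (Fin 3 → ℂ) →ₗ[ℂ] (Fin 3 → ℂ)} {T : StructureConstants ℂ}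
    (hm : ∀ i j, m (basisTri i) (basisTri j) = ∑ k, T.m i j k • basisTri k)
    (hu : T.u = ![1, 1, 0])
    (hd : ∀ x y z : Fin 3 → ℂ, e₁ = x + y → e₂ = y → e₃ = z →
      ∀ i, ![d₁ - d₂, d₂, d₃] i =
        ∑ j, ∑ k, T.d i j k • (![x, y, z] j ⊗ₜ ![x, y, z] k))
    (he : ∀ i, ![c₁ - c₂, c₂, c₃] i = T.e i) :
    (quintuple m d₁ d₂ d₃ c₁ c₂ c₃).HasConstants basisTri T where
  mul := hm
  one := by rw [hu]; exact one_basisTri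
  comul i := by
    have := hd (e₁ - e₂) e₂ e₃ (by abel) rfl rfl i
    rw [coe_basisTri]
    refine Eq.trans ?_ this
    fin_cases i <;> simp [quintuple, lin_e₁, lin_e₂, lin_e₃]
  counit i := by
    refine Eq.trans ?_ (he i)
    rw [coe_basisTri]
    fin_cases i <;> simp [quintuple, lin_e₁, lin_e₂, lin_e₃]

theorem hasConstants_structures_0 : (structures 0).HasConstants basisIdem (functions ℂ
    ![![some 1, some 2, some 0], ![some 2, some 0, some 1], ![some 0, some 1, some 2]]
    ![0, 0, 1]) := by
  refine hasConstants_functions (fun x y z h₁ h₂ h₃ i => ?_) (fun i => ?_)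
  · rw [h₁, h₂, h₃]
    fin_cases i <;> simp [Fin.sum_univ_three, TensorProduct.add_tmul, TensorProduct.sub_tmul,
      TensorProduct.tmul_add, TensorProduct.tmul_sub, two_smul] <;> abel
  · fin_cases i <;> norm_num

theorem hasConstants_structures_1 : (structures 1).HasConstants basisIdem (functions ℂ
    ![![some 0, some 0, some 0], ![some 0, some 1, some 1], ![some 0, some 1, some 2]]
    ![0, 0, 1]) := by
  refine hasConstants_functions (fun x y z h₁ h₂ h₃ i => ?_) (fun i => ?_)
  · rw [h₁, h₂, h₃]
    fin_cases i <;> simp [Fin.sum_univ_three, TensorProduct.add_tmul, TensorProduct.sub_tmul,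
      TensorProduct.tmul_add, TensorProduct.tmul_sub, two_smul] <;> abel
  · fin_cases i <;> norm_num

theorem hasConstants_structures_2 : (structures 2).HasConstants basisIdem (functions ℂ
    ![![some 0, some 0, some 0], ![some 0, some 1, some 2], ![some 0, some 2, some 1]]
    ![0, 1, 0]) := by
  refine hasConstants_functions (fun x y z h₁ h₂ h₃ i => ?_) (fun i => ?_)
  · rw [h₁, h₂, h₃]
    fin_cases i <;> simp [Fin.sum_univ_three, TensorProduct.add_tmul, TensorProduct.sub_tmul,
      TensorProduct.tmul_add, TensorProduct.tmul_sub, two_smul] <;> abel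
  · fin_cases i <;> norm_num

theorem hasConstants_structures_3 : (structures 3).HasConstants basisIdem (functions ℂ
    ![![some 0, some 0, some 0], ![some 0, some 0, some 1], ![some 0, some 1, some 2]]
    ![0, 0, 1]) := by
  refine hasConstants_functions (fun x y z h₁ h₂ h₃ i => ?_) (fun i => ?_)
  · rw [h₁, h₂, h₃]
    fin_cases i <;> simp [Fin.sum_univ_three, TensorProduct.add_tmul, TensorProduct.sub_tmul,
      TensorProduct.tmul_add, TensorProduct.tmul_sub, two_smul] <;> abel
  · fin_cases i <;> norm_num

theorem hasConstants_structures_4 : (structures 4).HasConstants basisIdem (functions ℂ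
    ![![some 0, some 0, some 2], ![some 0, some 1, some 2], ![some 0, some 2, some 2]]
    ![0, 1, 0]) := by
  refine hasConstants_functions (fun x y z h₁ h₂ h₃ i => ?_) (fun i => ?_)
  · rw [h₁, h₂, h₃]
    fin_cases i <;> simp [Fin.sum_univ_three, TensorProduct.add_tmul, TensorProduct.sub_tmul,
      TensorProduct.tmul_add, TensorProduct.tmul_sub, two_smul] <;> abel
  · fin_cases i <;> norm_num

theorem hasConstants_structures_5 : (structures 5).HasConstants basisIdem (functions ℂ
    ![![some 0, some 0, some 0], ![some 0, some 1, some 2], ![some 2, some 2, some 2]]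
    ![0, 1, 0]) := by
  refine hasConstants_functions (fun x y z h₁ h₂ h₃ i => ?_) (fun i => ?_)
  · rw [h₁, h₂, h₃]
    fin_cases i <;> simp [Fin.sum_univ_three, TensorProduct.add_tmul, TensorProduct.sub_tmul,
      TensorProduct.tmul_add, TensorProduct.tmul_sub, two_smul] <;> abel
  · fin_cases i <;> norm_num

theorem hasConstants_structures_6 : (structures 6).HasConstants basisIdem (functions ℂ
    ![![some 1, some 0, some 0], ![some 0, some 1, some 1], ![some 0, some 1, some 2]]
    ![0, 0, 1]) := by
  refine hasConstants_functions (fun x y z h₁ h₂ h₃ i => ?_) (fun i => ?_)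
  · rw [h₁, h₂, h₃]
    fin_cases i <;> simp [Fin.sum_univ_three, TensorProduct.add_tmul, TensorProduct.sub_tmul,
      TensorProduct.tmul_add, TensorProduct.tmul_sub, two_smul] <;> abel
  · fin_cases i <;> norm_num

theorem hasConstants_structures_7 : (structures 7).HasConstants basisIdem (functions ℂ
    ![![some 0, none, none], ![none, some 1, some 1], ![none, some 1, some 2]]
    ![1, 0, 1]) := by
  refine hasConstants_functions (fun x y z h₁ h₂ h₃ i => ?_) (fun i => ?_)
  · rw [h₁, h₂, h₃]
    fin_cases i <;> simp [Fin.sum_univ_three, TensorProduct.add_tmul, TensorProduct.sub_tmul,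
      TensorProduct.tmul_add, TensorProduct.tmul_sub, two_smul] <;> abel
  · fin_cases i <;> norm_num

theorem hasConstants_structures_8 : (structures 8).HasConstants basisIdem (functions ℂ
    ![![some 0, none, none], ![none, some 1, some 2], ![none, some 2, some 1]]
    ![1, 1, 0]) := by
  refine hasConstants_functions (fun x y z h₁ h₂ h₃ i => ?_) (fun i => ?_)
  · rw [h₁, h₂, h₃]
    fin_cases i <;> simp [Fin.sum_univ_three, TensorProduct.add_tmul, TensorProduct.sub_tmul,
      TensorProduct.tmul_add, TensorProduct.tmul_sub, two_smul] <;> abel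
  · fin_cases i <;> norm_num

theorem hasConstants_structures_9 : (structures 9).HasConstants basisIdem (functions ℂ
    ![![some 0, none, none], ![none, some 1, none], ![none, none, some 2]]
    ![1, 1, 1]) := by
  refine hasConstants_functions (fun x y z h₁ h₂ h₃ i => ?_) (fun i => ?_)
  · rw [h₁, h₂, h₃]
    fin_cases i <;> simp [Fin.sum_univ_three, TensorProduct.add_tmul, TensorProduct.sub_tmul,
      TensorProduct.tmul_add, TensorProduct.tmul_sub, two_smul]
  · fin_cases i <;> norm_num

theorem hasConstants_structures_10 : (structures 10).HasConstants basisIdem (functions ℂ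
    ![![none, some 0, none], ![none, some 1, none], ![some 0, none, some 2]]
    ![0, 1, 1]) := by
  refine hasConstants_functions (fun x y z h₁ h₂ h₃ i => ?_) (fun i => ?_)
  · rw [h₁, h₂, h₃]
    fin_cases i <;> simp [Fin.sum_univ_three, TensorProduct.add_tmul, TensorProduct.sub_tmul,
      TensorProduct.tmul_add, TensorProduct.tmul_sub, two_smul] <;> abel
  · fin_cases i <;> norm_num

theorem hasConstants_structures_11 :
    (structures 11).HasConstants basisTri (dual 1 0 0) := by
  refine hasConstants_tri m₂_basisTri rfl (fun x y z h₁ h₂ h₃ i => ?_) (fun i => ?_)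
  · rw [h₁, h₂, h₃]
    fin_cases i <;> simp [dual, Fin.sum_univ_three, TensorProduct.add_tmul,
      TensorProduct.sub_tmul, TensorProduct.tmul_add, TensorProduct.tmul_sub] <;> abel
  · fin_cases i <;> simp [dual]

theorem hasConstants_structures_12 :
    (structures 12).HasConstants basisTri (dual 0 0 1) := by
  refine hasConstants_tri m₂_basisTri rfl (fun x y z h₁ h₂ h₃ i => ?_) (fun i => ?_)
  · rw [h₁, h₂, h₃]
    fin_cases i <;> simp [dual, Fin.sum_univ_three, TensorProduct.add_tmul,
      TensorProduct.sub_tmul, TensorProduct.tmul_add, TensorProduct.tmul_sub] <;> abel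
  · fin_cases i <;> simp [dual]

theorem hasConstants_structures_13 :
    (structures 13).HasConstants basisTri (dual 0 1 0) := by
  refine hasConstants_tri m₂_basisTri rfl (fun x y z h₁ h₂ h₃ i => ?_) (fun i => ?_)
  · rw [h₁, h₂, h₃]
    fin_cases i <;> simp [dual, Fin.sum_univ_three, TensorProduct.add_tmul,
      TensorProduct.sub_tmul, TensorProduct.tmul_add, TensorProduct.tmul_sub] <;> abel
  · fin_cases i <;> simp [dual]

theorem hasConstants_structures_14 :
    (structures 14).HasConstants basisTri (dual 0 0 0) := by
  refine hasConstants_tri m₂_basisTri rfl (fun x y z h₁ h₂ h₃ i => ?_) (fun i => ?_)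
  · rw [h₁, h₂, h₃]
    fin_cases i <;> simp [dual, Fin.sum_univ_three, TensorProduct.add_tmul,
      TensorProduct.sub_tmul, TensorProduct.tmul_add, TensorProduct.tmul_sub] <;> abel
  · fin_cases i <;> simp [dual]

theorem hasConstants_structures_15 :
    (structures 15).HasConstants basisTri (arrow ℂ) := by
  refine hasConstants_tri m₅_basisTri rfl (fun x y z h₁ h₂ h₃ i => ?_) (fun i => ?_)
  · rw [h₁, h₂, h₃]
    fin_cases i <;> simp [arrow, Fin.sum_univ_three, TensorProduct.add_tmul,
      TensorProduct.sub_tmul, TensorProduct.tmul_add, TensorProduct.tmul_sub]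
  · fin_cases i <;> simp [arrow] <;> norm_num

theorem hasConstants_structures_16 :
    (structures 16).HasConstants basisTri (triangularLeft 0 0) := by
  refine hasConstants_tri m₅_basisTri rfl (fun x y z h₁ h₂ h₃ i => ?_) (fun i => ?_)
  · rw [h₁, h₂, h₃]
    fin_cases i <;> simp [triangularLeft, Fin.sum_univ_three, TensorProduct.add_tmul,
      TensorProduct.sub_tmul, TensorProduct.tmul_add, TensorProduct.tmul_sub] <;> module
  · fin_cases i <;> simp [triangularLeft]

theorem hasConstants_structures_17 :
    (structures 17).HasConstants basisTri (triangularLeft (-1) 0) := by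
  refine hasConstants_tri m₅_basisTri rfl (fun x y z h₁ h₂ h₃ i => ?_) (fun i => ?_)
  · rw [h₁, h₂, h₃]
    fin_cases i <;> simp [triangularLeft, Fin.sum_univ_three, TensorProduct.add_tmul,
      TensorProduct.sub_tmul, TensorProduct.tmul_add, TensorProduct.tmul_sub] <;> module
  · fin_cases i <;> simp [triangularLeft]

theorem hasConstants_structures_18 :
    (structures 18).HasConstants basisTri (triangularRight 0 0) := by
  refine hasConstants_tri m₅_basisTri rfl (fun x y z h₁ h₂ h₃ i => ?_) (fun i => ?_)
  · rw [h₁, h₂, h₃]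
    fin_cases i <;> simp [triangularRight, Fin.sum_univ_three, TensorProduct.add_tmul,
      TensorProduct.sub_tmul, TensorProduct.tmul_add, TensorProduct.tmul_sub] <;> module
  · fin_cases i <;> simp [triangularRight]

theorem hasConstants_structures_19 :
    (structures 19).HasConstants basisTri (triangularRight 1 0) := by
  refine hasConstants_tri m₅_basisTri rfl (fun x y z h₁ h₂ h₃ i => ?_) (fun i => ?_)
  · rw [h₁, h₂, h₃]
    fin_cases i <;> simp [triangularRight, Fin.sum_univ_three, TensorProduct.add_tmul,
      TensorProduct.sub_tmul, TensorProduct.tmul_add, TensorProduct.tmul_sub] <;> module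
  · fin_cases i <;> simp [triangularRight]

end WeakBialgebraDimThree

/-! ### Verification of the axioms over ℤ and base change to ℂ. -/

namespace StructureConstants

/-- Transport of structure constants along a ring homomorphism. -/
def map {R S : Type*} [CommRing R] [CommRing S] (f : R →+* S) (T : StructureConstants R) :
    StructureConstants S where
  m i j k := f (T.m i j k)
  u i := f (T.u i)
  d i j k := f (T.d i j k)
  e i := f (T.e i)

theorem eq_of_forall {R : Type*} {S T : StructureConstants R}
    (hm : ∀ i j k, S.m i j k = T.m i j k) (hu : ∀ i, S.u i = T.u i)
    (hd : ∀ i j k, S.d i j k = T.d i j k) (he : ∀ i, S.e i = T.e i) : S = T := by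
  obtain ⟨m, u, d, e⟩ := S
  obtain ⟨m', u', d', e'⟩ := T
  obtain rfl : m = m' := funext fun i => funext fun j => funext fun k => hm i j k
  obtain rfl : u = u' := funext hu
  obtain rfl : d = d' := funext fun i => funext fun j => funext fun k => hd i j k
  obtain rfl : e = e' := funext he
  rfl

section

variable {R S : Type*} [CommRing R] [CommRing S] (f : R →+* S) {T : StructureConstants R}

theorem IsAlgebra.map (h : T.IsAlgebra) : (T.map f).IsAlgebra where
  mul_assoc i j k l := by
    simpa [StructureConstants.map] using congrArg f (h.mul_assoc i j k l)
  mul_one i k := by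
    simpa [StructureConstants.map] using congrArg f (h.mul_one i k)
  one_mul i k := by
    simpa [StructureConstants.map] using congrArg f (h.one_mul i k)

theorem comulOne_map (p q : Fin 3) : (T.map f).comulOne p q = f (T.comulOne p q) := by
  simp [StructureConstants.map, comulOne]

theorem IsCompatible.map (h : T.IsCompatible) : (T.map f).IsCompatible where
  coassoc i p q r := by
    simpa [StructureConstants.map] using congrArg f (h.coassoc i p q r)
  counit_left i k := by
    simpa [StructureConstants.map] using congrArg f (h.counit_left i k)
  counit_right i k := by
    simpa [StructureConstants.map] using congrArg f (h.counit_right i k)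
  comul_mul i j p q := by
    simpa [StructureConstants.map] using congrArg f (h.comul_mul i j p q)
  comul_one_left p q r := by
    simp only [comulOne_map]
    simpa [StructureConstants.map] using congrArg f (h.comul_one_left p q r)
  comul_one_right p q r := by
    simp only [comulOne_map]
    simpa [StructureConstants.map] using congrArg f (h.comul_one_right p q r)
  counit_mul i j k := by
    simpa [StructureConstants.map] using congrArg f (h.counit_mul i j k)

theorem functions_map (μ : Fin 3 → Fin 3 → Option (Fin 3)) (e : Fin 3 → R) :
    (functions R μ e).map f = functions S μ (f ∘ e) := by
  apply eq_of_forall <;> intros <;> simp [functions, StructureConstants.map, mulDiag]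

theorem dual_map (l r c : R) : (dual l r c).map f = dual (f l) (f r) (f c) := by
  apply eq_of_forall
  · intro i j k
    fin_cases i <;> fin_cases j <;> fin_cases k <;> simp [dual, StructureConstants.map, mulDual]
  · intro i
    fin_cases i <;> simp [dual, StructureConstants.map]
  · intro i j k
    fin_cases i <;> fin_cases j <;> fin_cases k <;> simp [dual, StructureConstants.map]
  · intro i
    fin_cases i <;> simp [dual, StructureConstants.map]

theorem arrow_map : (arrow R).map f = arrow S := by
  apply eq_of_forall
  · intro i j k
    fin_cases i <;> fin_cases j <;> fin_cases k <;> simp [arrow, StructureConstants.map, mulTriangular]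
  · intro i
    fin_cases i <;> simp [arrow, StructureConstants.map]
  · intro i j k
    fin_cases i <;> fin_cases j <;> fin_cases k <;> simp [arrow, StructureConstants.map]
  · intro i
    fin_cases i <;> simp [arrow, StructureConstants.map]

theorem triangularLeft_map (y c : R) : (triangularLeft y c).map f = triangularLeft (f y) (f c) := by
  apply eq_of_forall
  · intro i j k
    fin_cases i <;> fin_cases j <;> fin_cases k <;> simp [triangularLeft, StructureConstants.map, mulTriangular]
  · intro i
    fin_cases i <;> simp [triangularLeft, StructureConstants.map]
  · intro i j k
    fin_cases i <;> fin_cases j <;> fin_cases k <;> simp [triangularLeft, StructureConstants.map]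
  · intro i
    fin_cases i <;> simp [triangularLeft, StructureConstants.map]

theorem triangularRight_map (y c : R) : (triangularRight y c).map f = triangularRight (f y) (f c) := by
  apply eq_of_forall
  · intro i j k
    fin_cases i <;> fin_cases j <;> fin_cases k <;> simp [triangularRight, StructureConstants.map, mulTriangular]
  · intro i
    fin_cases i <;> simp [triangularRight, StructureConstants.map]
  · intro i j k
    fin_cases i <;> fin_cases j <;> fin_cases k <;> simp [triangularRight, StructureConstants.map]
  · intro i
    fin_cases i <;> simp [triangularRight, StructureConstants.map]

end

/-- Equality in ℤ can be decided by evaluation. The algebra axioms see only `m` and `u`, so after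
unfolding the parameters `μ` and `e` are gone and the goal is closed; the same holds for the other
families. -/
theorem isAlgebra_functions (μ : Fin 3 → Fin 3 → Option (Fin 3)) (e : Fin 3 → ℤ) :
    (functions ℤ μ e).IsAlgebra := by
  refine ⟨?_, ?_, ?_⟩ <;> simp only [functions] <;> decide +kernel

theorem isAlgebra_dual (l r c : ℤ) : (dual l r c).IsAlgebra := by
  refine ⟨?_, ?_, ?_⟩ <;> simp only [dual] <;> decide +kernel

theorem isAlgebra_arrow : (arrow ℤ).IsAlgebra := by
  refine ⟨?_, ?_, ?_⟩ <;> simp only [arrow] <;> decide +kernel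

theorem isAlgebra_triangularLeft (y c : ℤ) : (triangularLeft y c).IsAlgebra := by
  refine ⟨?_, ?_, ?_⟩ <;> simp only [triangularLeft] <;> decide +kernel

theorem isAlgebra_triangularRight (y c : ℤ) : (triangularRight y c).IsAlgebra := by
  refine ⟨?_, ?_, ?_⟩ <;> simp only [triangularRight] <;> decide +kernel

end StructureConstants

namespace WeakBialgebraDimThree
open StructureConstants WeakBialgebraData

/-- The complex constants are the images of integer ones, and a ring homomorphism preserves
polynomial identities. -/
theorem isWeakBialgebra_of_functions {B : WeakBialgebraData ℂ (Fin 3 → ℂ)}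
    {b : Module.Basis (Fin 3) ℂ (Fin 3 → ℂ)} {μ : Fin 3 → Fin 3 → Option (Fin 3)} {x y z : ℂ}
    (x' y' z' : ℤ) (h : B.HasConstants b (functions ℂ μ ![x, y, z]))
    (hx : (x' : ℂ) = x) (hy : (y' : ℂ) = y) (hz : (z' : ℂ) = z)
    (hC : (functions ℤ μ ![x', y', z']).IsCompatible) : B.IsWeakBialgebra := by
  have key : (functions ℤ μ ![x', y', z']).map (Int.castRingHom ℂ) =
      functions ℂ μ ![x, y, z] := by
    rw [functions_map]
    congr 1
    ext i
    fin_cases i <;> simp [hx, hy, hz]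
  rw [← key] at h
  exact h.isWeakBialgebra ((isAlgebra_functions _ _).map _) (hC.map _)

theorem isWeakBialgebra_of_dual {B : WeakBialgebraData ℂ (Fin 3 → ℂ)}
    {b : Module.Basis (Fin 3) ℂ (Fin 3 → ℂ)} {l r c : ℂ} (l' r' c' : ℤ)
    (h : B.HasConstants b (dual l r c))
    (hl : (l' : ℂ) = l) (hr : (r' : ℂ) = r) (hc : (c' : ℂ) = c)
    (hC : (dual l' r' c').IsCompatible) : B.IsWeakBialgebra := by
  have key : (dual l' r' c').map (Int.castRingHom ℂ) = dual l r c := by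
    rw [dual_map]
    simp [hl, hr, hc]
  rw [← key] at h
  exact h.isWeakBialgebra ((isAlgebra_dual _ _ _).map _) (hC.map _)

theorem isWeakBialgebra_of_triangularLeft {B : WeakBialgebraData ℂ (Fin 3 → ℂ)}
    {b : Module.Basis (Fin 3) ℂ (Fin 3 → ℂ)} {y : ℂ} (y' : ℤ)
    (h : B.HasConstants b (triangularLeft y 0)) (hy : (y' : ℂ) = y)
    (hC : (triangularLeft y' 0).IsCompatible) : B.IsWeakBialgebra := by
  have key : (triangularLeft y' 0).map (Int.castRingHom ℂ) = triangularLeft y 0 := by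
    rw [triangularLeft_map]
    simp [hy]
  rw [← key] at h
  exact h.isWeakBialgebra ((isAlgebra_triangularLeft _ _).map _) (hC.map _)

theorem isWeakBialgebra_of_triangularRight {B : WeakBialgebraData ℂ (Fin 3 → ℂ)}
    {b : Module.Basis (Fin 3) ℂ (Fin 3 → ℂ)} {y : ℂ} (y' : ℤ)
    (h : B.HasConstants b (triangularRight y 0)) (hy : (y' : ℂ) = y)
    (hC : (triangularRight y' 0).IsCompatible) : B.IsWeakBialgebra := by
  have key : (triangularRight y' 0).map (Int.castRingHom ℂ) = triangularRight y 0 := by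
    rw [triangularRight_map]
    simp [hy]
  rw [← key] at h
  exact h.isWeakBialgebra ((isAlgebra_triangularRight _ _).map _) (hC.map _)

set_option maxRecDepth 100000 in
theorem isWeakBialgebra_structures_0 : (structures 0).IsWeakBialgebra :=
  isWeakBialgebra_of_functions 0 0 1 hasConstants_structures_0 (by simp) (by simp) (by simp)
    (by constructor <;> decide +kernel)

set_option maxRecDepth 100000 in
theorem isWeakBialgebra_structures_1 : (structures 1).IsWeakBialgebra :=
  isWeakBialgebra_of_functions 0 0 1 hasConstants_structures_1 (by simp) (by simp) (by simp)
    (by constructor <;> decide +kernel)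

set_option maxRecDepth 100000 in
theorem isWeakBialgebra_structures_2 : (structures 2).IsWeakBialgebra :=
  isWeakBialgebra_of_functions 0 1 0 hasConstants_structures_2 (by simp) (by simp) (by simp)
    (by constructor <;> decide +kernel)

set_option maxRecDepth 100000 in
theorem isWeakBialgebra_structures_3 : (structures 3).IsWeakBialgebra :=
  isWeakBialgebra_of_functions 0 0 1 hasConstants_structures_3 (by simp) (by simp) (by simp)
    (by constructor <;> decide +kernel)

set_option maxRecDepth 100000 in
theorem isWeakBialgebra_structures_4 : (structures 4).IsWeakBialgebra :=
  isWeakBialgebra_of_functions 0 1 0 hasConstants_structures_4 (by simp) (by simp) (by simp)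
    (by constructor <;> decide +kernel)

set_option maxRecDepth 100000 in
theorem isWeakBialgebra_structures_5 : (structures 5).IsWeakBialgebra :=
  isWeakBialgebra_of_functions 0 1 0 hasConstants_structures_5 (by simp) (by simp) (by simp)
    (by constructor <;> decide +kernel)

set_option maxRecDepth 100000 in
theorem isWeakBialgebra_structures_6 : (structures 6).IsWeakBialgebra :=
  isWeakBialgebra_of_functions 0 0 1 hasConstants_structures_6 (by simp) (by simp) (by simp)
    (by constructor <;> decide +kernel)

set_option maxRecDepth 100000 in
theorem isWeakBialgebra_structures_7 : (structures 7).IsWeakBialgebra :=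
  isWeakBialgebra_of_functions 1 0 1 hasConstants_structures_7 (by simp) (by simp) (by simp)
    (by constructor <;> decide +kernel)

set_option maxRecDepth 100000 in
theorem isWeakBialgebra_structures_8 : (structures 8).IsWeakBialgebra :=
  isWeakBialgebra_of_functions 1 1 0 hasConstants_structures_8 (by simp) (by simp) (by simp)
    (by constructor <;> decide +kernel)

set_option maxRecDepth 100000 in
theorem isWeakBialgebra_structures_9 : (structures 9).IsWeakBialgebra :=
  isWeakBialgebra_of_functions 1 1 1 hasConstants_structures_9 (by simp) (by simp) (by simp)
    (by constructor <;> decide +kernel)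

set_option maxRecDepth 100000 in
theorem isWeakBialgebra_structures_10 : (structures 10).IsWeakBialgebra :=
  isWeakBialgebra_of_functions 0 1 1 hasConstants_structures_10 (by simp) (by simp) (by simp)
    (by constructor <;> decide +kernel)

set_option maxRecDepth 100000 in
theorem isWeakBialgebra_structures_11 : (structures 11).IsWeakBialgebra :=
  isWeakBialgebra_of_dual 1 0 0 hasConstants_structures_11 (by simp) (by simp) (by simp)
    (by constructor <;> decide +kernel)

set_option maxRecDepth 100000 in
theorem isWeakBialgebra_structures_12 : (structures 12).IsWeakBialgebra :=
  isWeakBialgebra_of_dual 0 0 1 hasConstants_structures_12 (by simp) (by simp) (by simp)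
    (by constructor <;> decide +kernel)

set_option maxRecDepth 100000 in
theorem isWeakBialgebra_structures_13 : (structures 13).IsWeakBialgebra :=
  isWeakBialgebra_of_dual 0 1 0 hasConstants_structures_13 (by simp) (by simp) (by simp)
    (by constructor <;> decide +kernel)

set_option maxRecDepth 100000 in
theorem isWeakBialgebra_structures_14 : (structures 14).IsWeakBialgebra :=
  isWeakBialgebra_of_dual 0 0 0 hasConstants_structures_14 (by simp) (by simp) (by simp)
    (by constructor <;> decide +kernel)

set_option maxRecDepth 100000 in
theorem isWeakBialgebra_structures_15 : (structures 15).IsWeakBialgebra := by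
  have h := hasConstants_structures_15
  rw [← arrow_map (Int.castRingHom ℂ)] at h
  exact h.isWeakBialgebra (isAlgebra_arrow.map _)
    (IsCompatible.map _ (by constructor <;> decide +kernel))

set_option maxRecDepth 100000 in
theorem isWeakBialgebra_structures_16 : (structures 16).IsWeakBialgebra :=
  isWeakBialgebra_of_triangularLeft 0 hasConstants_structures_16 (by simp)
    (by constructor <;> decide +kernel)

set_option maxRecDepth 100000 in
theorem isWeakBialgebra_structures_17 : (structures 17).IsWeakBialgebra :=
  isWeakBialgebra_of_triangularLeft (-1) hasConstants_structures_17 (by simp)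
    (by constructor <;> decide +kernel)

set_option maxRecDepth 100000 in
theorem isWeakBialgebra_structures_18 : (structures 18).IsWeakBialgebra :=
  isWeakBialgebra_of_triangularRight 0 hasConstants_structures_18 (by simp)
    (by constructor <;> decide +kernel)

set_option maxRecDepth 100000 in
theorem isWeakBialgebra_structures_19 : (structures 19).IsWeakBialgebra :=
  isWeakBialgebra_of_triangularRight 1 hasConstants_structures_19 (by simp)
    (by constructor <;> decide +kernel)

theorem isWeakBialgebra_structures (i : Fin 20) : (structures i).IsWeakBialgebra := by
  fin_cases i
  · exact isWeakBialgebra_structures_0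
  · exact isWeakBialgebra_structures_1
  · exact isWeakBialgebra_structures_2
  · exact isWeakBialgebra_structures_3
  · exact isWeakBialgebra_structures_4
  · exact isWeakBialgebra_structures_5
  · exact isWeakBialgebra_structures_6
  · exact isWeakBialgebra_structures_7
  · exact isWeakBialgebra_structures_8
  · exact isWeakBialgebra_structures_9
  · exact isWeakBialgebra_structures_10
  · exact isWeakBialgebra_structures_11
  · exact isWeakBialgebra_structures_12
  · exact isWeakBialgebra_structures_13
  · exact isWeakBialgebra_structures_14
  · exact isWeakBialgebra_structures_15
  · exact isWeakBialgebra_structures_16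
  · exact isWeakBialgebra_structures_17
  · exact isWeakBialgebra_structures_18
  · exact isWeakBialgebra_structures_19

end WeakBialgebraDimThree

/-! ### The algebra K³: categories with three morphisms. -/

namespace StructureConstants

section Diagonal

variable {K : Type*} [Field K] {d : Fin 3 → Fin 3 → Fin 3 → K} {e : Fin 3 → K}

/-- Multiplication in K³ ⊗ K³ is pointwise, so multiplicativity of Δ makes the images of the
primitive idempotents orthogonal idempotents of K⁹. -/
theorem diag_mul (h : IsCompatible ⟨mulDiag K, 1, d, e⟩) (i j p q : Fin 3) :
    d i p q * d j p q = if i = j then d i p q else 0 := by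
  have := h.comul_mul i j p q
  simp [mulDiag, ite_and] at this
  rw [← this]
  split_ifs with hij
  · rw [hij]
  · rfl

theorem diag_counit (h : IsCompatible ⟨mulDiag K, 1, d, e⟩) (i j k : Fin 3) :
    d j i k * (e i * e k) = if i = j ∧ j = k then e i else 0 := by
  have := h.counit_mul i j k
  simp [mulDiag, ite_and] at this
  rw [← this]
  by_cases hij : i = j
  · by_cases hjk : j = k <;> simp [hij, hjk]
  · simp [hij]

/-- Once the inner sums are 0 or 1 according to whether a product is defined, this says that (pq)r
is defined exactly when pq and qr both are: the composability law of a category. -/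
theorem diag_one (h : IsCompatible ⟨mulDiag K, 1, d, e⟩) (p q r : Fin 3) :
    ∑ a, (∑ c, d c a r) * d a p q = (∑ c, d c p q) * (∑ c, d c q r) := by
  have := h.comul_one_left p q r
  simpa [mulDiag, ite_and, comulOne] using this

/-- Associativity and definedness of a partial multiplication together with units. -/
def IsCategory (μ : Fin 3 → Fin 3 → Option (Fin 3)) (s : Fin 3 → Bool) : Prop :=
  (∀ p q r, (μ p q).bind (fun a => μ a r) = (μ q r).bind (fun a => μ p a)) ∧
  (∀ p q r, (μ p q).isSome → (μ q r).isSome → ((μ p q).bind (fun a => μ a r)).isSome) ∧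
  (∀ i j, s i → s j → μ i j = if i = j then some i else none) ∧
  (∀ i j, s i → μ i j = none ∨ μ i j = some j) ∧
  (∀ i j, s i → μ j i = none ∨ μ j i = some j) ∧
  (∀ j, ∃ i, s i ∧ μ i j = some j) ∧ (∀ j, ∃ i, s i ∧ μ j i = some j)

instance (μ : Fin 3 → Fin 3 → Option (Fin 3)) (s : Fin 3 → Bool) : Decidable (IsCategory μ s) := by
  unfold IsCategory; infer_instance

/-- For a pair (i, j) at most one idempotent Δ(p_k) has a nonzero entry there, by orthogonality, and
that entry is 1. This k is the product of i and j. -/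
theorem exists_partialMul (h : IsCompatible ⟨mulDiag K, 1, d, e⟩) :
    ∃ μ : Fin 3 → Fin 3 → Option (Fin 3), d = fun k i j => if μ i j = some k then 1 else 0 := by
  classical
  have key : ∀ i j, ∃ o : Option (Fin 3), ∀ k, d k i j = if o = some k then 1 else 0 := by
    intro i j
    by_cases H : ∃ k, d k i j ≠ 0
    · obtain ⟨k, hk⟩ := H
      refine ⟨some k, fun l => ?_⟩
      have := diag_mul h k l i j
      by_cases hkl : k = l
      · subst hkl
        simpa [hk] using this
      · simpa [hk, hkl] using this
    · push Not at H
      exact ⟨none, fun k => by simp [H]⟩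
  choose μ hμ using key
  exact ⟨μ, funext fun k => funext fun i => funext fun j => hμ i j k⟩

/-- If ε(p_i) is nonzero, `diag_counit` at (i, i, i) makes it inverse to `d i i i`, which is
idempotent and hence 1. -/
theorem exists_bool_counit (h : IsCompatible ⟨mulDiag K, 1, d, e⟩) :
    ∃ s : Fin 3 → Bool, e = fun i => if s i then 1 else 0 := by
  classical
  refine ⟨fun i => decide (e i ≠ 0), funext fun i => ?_⟩
  have h₁ := diag_counit h i i i
  have h₂ := diag_mul h i i i i
  by_cases he : e i = 0
  · simp [he]
  · simp only [ne_eq, he, not_false_eq_true, decide_true, if_true]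
    simp only [and_self, if_true] at h₁ h₂
    have h₃ : d i i i * e i = 1 := mul_right_cancel₀ he (by rw [one_mul, mul_assoc, h₁])
    have h₄ : d i i i = 1 := by
      have : d i i i ≠ 0 := left_ne_zero_of_mul_eq_one h₃
      exact mul_right_cancel₀ this (by rw [one_mul, h₂])
    rwa [h₄, one_mul] at h₃

theorem isCategory_of_isCompatible [CharZero K] {μ : Fin 3 → Fin 3 → Option (Fin 3)} {s : Fin 3 → Bool}
    (h : (functions K μ fun i => if s i then 1 else 0).IsCompatible) : IsCategory μ s := by
  have hs : ∀ i j, s i → s j → μ i j = if i = j then some i else none := by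
    intro i j hi hj
    have := fun k => diag_counit h i k j
    simp only [hi, hj, if_true, mul_one] at this
    by_cases hij : i = j
    · have := this i
      simpa [hij] using this
    · rw [if_neg hij]
      by_contra hne
      obtain ⟨k, hk⟩ := Option.ne_none_iff_exists'.1 hne
      have := this k
      rw [if_pos hk, if_neg (fun hh => hij (hh.1.trans hh.2))] at this
      exact one_ne_zero this
  -- The numerals here are natural numbers: characteristic zero turns the counit law into a count of
  -- identities, so that a vanishing sum has only vanishing terms.
  have hl : ∀ j k, ∑ i, (if s i then 1 else 0) * (if μ i j = some k then 1 else 0) =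
      if j = k then 1 else 0 := by
    intro j k
    have := h.counit_left k j
    simp only [functions, eq_comm (a := k)] at this
    exact_mod_cast this
  have hr : ∀ j k, ∑ i, (if s i then 1 else 0) * (if μ j i = some k then 1 else 0) =
      if j = k then 1 else 0 := by
    intro j k
    have := h.counit_right k j
    simp only [functions, eq_comm (a := k)] at this
    exact_mod_cast this
  have hone := diag_one h
  -- The coordinates of Δ(1) record which products are defined.
  have hD : ∀ i j, ∑ c, (if μ i j = some c then (1 : K) else 0) =
      if (μ i j).isSome then 1 else 0 := by
    intro i j
    cases μ i j <;> simp
  simp only [hD] at hone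
  have hass := h.coassoc
  simp only [functions] at hass
  refine ⟨fun p q r => ?_, fun p q r hpq hqr => ?_, hs, fun i j hi => ?_, fun i j hi => ?_,
    fun j => ?_, fun j => ?_⟩
  · ext k
    have := hass k p q r
    have hbind : ∀ (o : Option (Fin 3)) (g : Fin 3 → Option (Fin 3)),
        ∑ a, (if g a = some k then (1 : K) else 0) * (if o = some a then 1 else 0) =
          if o.bind g = some k then 1 else 0 := by
      intro o g
      cases o <;> simp
    rw [hbind (μ p q) fun a => μ a r, hbind (μ q r) fun a => μ p a] at this
    by_cases h₁ : (μ p q).bind (fun a => μ a r) = some k <;>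
      by_cases h₂ : (μ q r).bind (fun a => μ p a) = some k <;> simp_all
  · have := hone p q r
    rw [if_pos hpq, if_pos hqr] at this
    obtain ⟨a, ha⟩ := Option.isSome_iff_exists.1 hpq
    by_contra hne
    simp [ha] at this hne
    simp [hne] at this
  · by_contra! hne
    obtain ⟨k, hk⟩ := Option.ne_none_iff_exists'.1 hne.1
    have := hl j k
    rw [if_neg (by rintro rfl; exact hne.2 hk), Finset.sum_eq_zero_iff] at this
    simpa [hi, hk] using this i
  · by_contra! hne
    obtain ⟨k, hk⟩ := Option.ne_none_iff_exists'.1 hne.1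
    have := hr j k
    rw [if_neg (by rintro rfl; exact hne.2 hk), Finset.sum_eq_zero_iff] at this
    simpa [hi, hk] using this i
  · have := hl j j
    rw [if_pos rfl] at this
    obtain ⟨i, -, hi⟩ := Finset.exists_ne_zero_of_sum_ne_zero (this.trans_ne one_ne_zero)
    exact ⟨i, by simpa [and_comm] using hi⟩
  · have := hr j j
    rw [if_pos rfl] at this
    obtain ⟨i, -, hi⟩ := Finset.exists_ne_zero_of_sum_ne_zero (this.trans_ne one_ne_zero)
    exact ⟨i, by simpa [and_comm] using hi⟩

end Diagonal

/-- The composition of the eleven categories with three morphisms. -/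
def categoryComp : Fin 11 → Fin 3 → Fin 3 → Option (Fin 3) :=
  ![![![some 1, some 2, some 0], ![some 2, some 0, some 1], ![some 0, some 1, some 2]],
    ![![some 0, some 0, some 0], ![some 0, some 1, some 1], ![some 0, some 1, some 2]],
    ![![some 0, some 0, some 0], ![some 0, some 1, some 2], ![some 0, some 2, some 1]],
    ![![some 0, some 0, some 0], ![some 0, some 0, some 1], ![some 0, some 1, some 2]],
    ![![some 0, some 0, some 2], ![some 0, some 1, some 2], ![some 0, some 2, some 2]],
    ![![some 0, some 0, some 0], ![some 0, some 1, some 2], ![some 2, some 2, some 2]],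
    ![![some 1, some 0, some 0], ![some 0, some 1, some 1], ![some 0, some 1, some 2]],
    ![![some 0, none, none], ![none, some 1, some 1], ![none, some 1, some 2]],
    ![![some 0, none, none], ![none, some 1, some 2], ![none, some 2, some 1]],
    ![![some 0, none, none], ![none, some 1, none], ![none, none, some 2]],
    ![![none, some 0, none], ![none, some 1, none], ![some 0, none, some 2]]]

/-- The identities of the eleven categories with three morphisms. -/
def categoryId : Fin 11 → Fin 3 → Bool :=
  ![![false, false, true],
    ![false, false, true],
    ![false, true, false],
    ![false, false, true],
    ![false, true, false],
    ![false, true, false],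
    ![false, false, true],
    ![true, false, true],
    ![true, true, false],
    ![true, true, true],
    ![false, true, true]]

/-- `(μ, s)` is isomorphic to one of the eleven categories with three morphisms. -/
def IsClassified (μ : Fin 3 → Fin 3 → Option (Fin 3)) (s : Fin 3 → Bool) : Prop :=
  ∃ (k : Fin 11) (σ : Equiv.Perm (Fin 3)),
    (∀ i j, categoryComp k (σ i) (σ j) = (μ i j).map σ) ∧ ∀ i, categoryId k (σ i) = s i

instance (μ : Fin 3 → Fin 3 → Option (Fin 3)) (s : Fin 3 → Bool) :
    Decidable (IsClassified μ s) := by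
  unfold IsClassified; infer_instance

set_option maxRecDepth 100000 in
-- Sorting the identities to the front and using the unit laws leaves only 4⁴ tables here, and 4⁵ in
-- the case of two objects, few enough to enumerate.
theorem isClassified_one_object : ∀ a b c d : Option (Fin 3),
    IsCategory ![![some 0, some 1, some 2], ![some 1, a, b], ![some 2, c, d]] ![true, false, false] →
    IsClassified ![![some 0, some 1, some 2], ![some 1, a, b], ![some 2, c, d]]
      ![true, false, false] := by
  decide +kernel

set_option maxRecDepth 100000 in
theorem isClassified_two_objects : ∀ a b c d e : Option (Fin 3),
    IsCategory ![![some 0, none, a], ![none, some 1, b], ![c, d, e]] ![true, true, false] →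
    IsClassified ![![some 0, none, a], ![none, some 1, b], ![c, d, e]] ![true, true, false] := by
  decide +kernel

theorem isClassified_three_objects :
    IsClassified ![![some 0, none, none], ![none, some 1, none], ![none, none, some 2]]
      ![true, true, true] := by
  decide +kernel
theorem exists_perm_sorted : ∀ s : Fin 3 → Bool, (∃ i, s i) → ∃ σ : Equiv.Perm (Fin 3),
    s ∘ σ = ![true, false, false] ∨ s ∘ σ = ![true, true, false] ∨ s ∘ σ = ![true, true, true] := by
  decide +kernel

/-- A single identity is a unit for everything and fixes the first row and column. Two identities
compose only with themselves, which fixes a 2 × 2 corner. Three identities leave only the discrete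
category. -/
theorem IsCategory.isClassified {μ : Fin 3 → Fin 3 → Option (Fin 3)} {s : Fin 3 → Bool}
    (h : IsCategory μ s) (hs : s = ![true, false, false] ∨ s = ![true, true, false] ∨
      s = ![true, true, true]) : IsClassified μ s := by
  have ⟨_, hdef, hid, hl, hr, hl', hr'⟩ := h
  rcases hs with rfl | rfl | rfl
  · have h0 : ∀ j, μ 0 j = some j := fun j => by
      obtain ⟨i, hi, hij⟩ := hl' j
      fin_cases i <;> simp_all
    have h1 : ∀ j, μ j 0 = some j := fun j => by
      obtain ⟨i, hi, hij⟩ := hr' j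
      fin_cases i <;> simp_all
    have hμ : μ = ![![some 0, some 1, some 2], ![some 1, μ 1 1, μ 1 2],
        ![some 2, μ 2 1, μ 2 2]] := by
      ext1 i; ext1 j
      fin_cases i <;> fin_cases j <;> simp [h0, h1]
    rw [hμ] at h ⊢
    exact isClassified_one_object _ _ _ _ h
  · have h01 := hid 0 1 rfl rfl
    have h10 := hid 1 0 rfl rfl
    have h00 := hid 0 0 rfl rfl
    have h11 := hid 1 1 rfl rfl
    simp at h01 h10 h00 h11
    have hμ : μ = ![![some 0, none, μ 0 2], ![none, some 1, μ 1 2],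
        ![μ 2 0, μ 2 1, μ 2 2]] := by
      ext1 i; ext1 j
      fin_cases i <;> fin_cases j <;> simp [h01, h10, h00, h11]
    rw [hμ] at h ⊢
    exact isClassified_two_objects _ _ _ _ _ h
  · obtain rfl : μ = ![![some 0, none, none], ![none, some 1, none], ![none, none, some 2]] := by
      ext1 i; ext1 j
      rw [hid i j (by fin_cases i <;> rfl) (by fin_cases j <;> rfl)]
      fin_cases i <;> fin_cases j <;> rfl
    exact isClassified_three_objects

end StructureConstants

namespace WeakBialgebraData
open StructureConstants WeakBialgebraDimThree

variable {K V W : Type*} [Field K] [AddCommGroup V] [Module K V]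

/-- The table of K³ is invariant under permutation of the idempotents, so a relabelling of the
morphisms is a change of basis. -/
theorem HasConstants.reindex {B : WeakBialgebraData K V} {b : Module.Basis (Fin 3) K V}
    {μ : Fin 3 → Fin 3 → Option (Fin 3)} {e : Fin 3 → K} (h : B.HasConstants b (functions K μ e))
    (σ : Equiv.Perm (Fin 3)) {μ' : Fin 3 → Fin 3 → Option (Fin 3)} {e' : Fin 3 → K}
    (hμ : ∀ i j, μ' (σ i) (σ j) = (μ i j).map σ) (he : ∀ i, e' (σ i) = e i) :
    B.HasConstants (b.reindex σ) (functions K μ' e') where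
  mul i j := by
    obtain ⟨i, rfl⟩ := σ.surjective i
    obtain ⟨j, rfl⟩ := σ.surjective j
    rw [← Equiv.sum_comp σ]
    simpa [functions, mulDiag] using h.mul i j
  one := by
    rw [← Equiv.sum_comp σ]
    simpa [functions] using h.one
  comul i := by
    obtain ⟨i, rfl⟩ := σ.surjective i
    rw [← Equiv.sum_comp σ]
    simp_rw [← Equiv.sum_comp σ (fun k => (functions K μ' e').d _ _ k • _)]
    have : ∀ j k, (μ j k).map σ = some (σ i) ↔ μ j k = some i := fun j k => by
      cases μ j k <;> simp
    simpa [functions, hμ, this] using h.comul i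
  counit i := by
    obtain ⟨i, rfl⟩ := σ.surjective i
    simpa [functions, he] using h.counit i

theorem hasConstants_category (k : Fin 11) :
    (structures (Fin.castLE (by norm_num) k)).HasConstants basisIdem
      (functions ℂ (categoryComp k) fun i => if categoryId k i then 1 else 0) := by
  have key : ∀ {B : WeakBialgebraData ℂ (Fin 3 → ℂ)} {μ : Fin 3 → Fin 3 → Option (Fin 3)}
      {e : Fin 3 → ℂ} {s : Fin 3 → Bool}, B.HasConstants basisIdem (functions ℂ μ e) →
      (∀ i, e i = if s i then 1 else 0) →
      B.HasConstants basisIdem (functions ℂ μ fun i => if s i then 1 else 0) := by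
    intro B μ e s h he
    rwa [← funext he]
  fin_cases k
  · exact key hasConstants_structures_0 fun i => by fin_cases i <;> simp [categoryId]
  · exact key hasConstants_structures_1 fun i => by fin_cases i <;> simp [categoryId]
  · exact key hasConstants_structures_2 fun i => by fin_cases i <;> simp [categoryId]
  · exact key hasConstants_structures_3 fun i => by fin_cases i <;> simp [categoryId]
  · exact key hasConstants_structures_4 fun i => by fin_cases i <;> simp [categoryId]
  · exact key hasConstants_structures_5 fun i => by fin_cases i <;> simp [categoryId]
  · exact key hasConstants_structures_6 fun i => by fin_cases i <;> simp [categoryId]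
  · exact key hasConstants_structures_7 fun i => by fin_cases i <;> simp [categoryId]
  · exact key hasConstants_structures_8 fun i => by fin_cases i <;> simp [categoryId]
  · exact key hasConstants_structures_9 fun i => by fin_cases i <;> simp [categoryId]
  · exact key hasConstants_structures_10 fun i => by fin_cases i <;> simp [categoryId]

theorem isomorphic_of_mulDiag {V : Type*} [AddCommGroup V] [Module ℂ V]
    {B : WeakBialgebraData ℂ V} (hB : B.IsWeakBialgebra) {b : Module.Basis (Fin 3) ℂ V}
    {d : Fin 3 → Fin 3 → Fin 3 → ℂ} {e : Fin 3 → ℂ} (h : B.HasConstants b ⟨mulDiag ℂ, 1, d, e⟩) :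
    ∃ i : Fin 20, B.Isomorphic (structures i) := by
  obtain ⟨μ, rfl⟩ := exists_partialMul (h.isCompatible hB)
  obtain ⟨s, rfl⟩ := exists_bool_counit (h.isCompatible hB)
  have h' : B.HasConstants b (functions ℂ μ fun i => if s i then 1 else 0) := h
  -- The left identity of morphism 0 shows that at least one identity exists, which the sorting
  -- requires.
  have hs := (isCategory_of_isCompatible (h'.isCompatible hB)).2.2.2.2.2.1 0
  obtain ⟨σ, hσ⟩ := exists_perm_sorted s (by obtain ⟨i, hi⟩ := hs; exact ⟨i, hi.1⟩)
  have h₂ : B.HasConstants (b.reindex σ.symm) (functions ℂ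
      (fun i j => (μ (σ i) (σ j)).map σ.symm) fun i => if (s ∘ σ) i then 1 else 0) :=
    h'.reindex σ.symm (by simp) (by simp)
  obtain ⟨k, τ, hτ⟩ := (isCategory_of_isCompatible (h₂.isCompatible hB)).isClassified hσ
  exact ⟨_, (h₂.reindex τ (e' := fun i => if categoryId k i then 1 else 0)
    hτ.1 fun i => by simp only [hτ.2]).isomorphic (hasConstants_category k)⟩

end WeakBialgebraData

/-! ### The algebra K × K[x]/(x²). -/

namespace StructureConstants

theorem eq_zero_or_one_of_eq_mul_self {K : Type*} [Field K] {x : K} (hx : x = x * x) :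
    x = 0 ∨ x = 1 := by
  rcases mul_eq_zero.1 (show x * (x - 1) = 0 by linear_combination -hx) with h | h
  · exact .inl h
  · exact .inr (sub_eq_zero.1 h)

/-- An idempotent has no nilpotent component: with `x` its scalar part and `y` the next coefficient,
(1 - 2x)y = 0, and 1 - 2x is 1 or -1. -/
theorem eq_zero_of_eq_mul_add_mul {K : Type*} [Field K] {x y : K} (hx : x = x * x)
    (hy : y = x * y + y * x) : y = 0 := by
  rcases eq_zero_or_one_of_eq_mul_self hx with rfl | rfl
  · simpa using hy
  · linear_combination -hy

section Dual

variable {K : Type*} [Field K] [CharZero K] {d : Fin 3 → Fin 3 → Fin 3 → K} {e : Fin 3 → K}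

/-- The tensor square splits into K, two copies of K[x]/(x²) and K[x, y]/(x², y²); the 3 × 3 table
lists the coordinates along these blocks. -/
theorem mulDual_tmul (s t : Fin 3 → Fin 3 → K) (p q : Fin 3) :
    ∑ a, ∑ b, ∑ c, ∑ f, s a b * t c f * (mulDual K a c p * mulDual K b f q) =
      ![![s 0 0 * t 0 0, s 0 1 * t 0 1, s 0 1 * t 0 2 + s 0 2 * t 0 1],
        ![s 1 0 * t 1 0, s 1 1 * t 1 1, s 1 1 * t 1 2 + s 1 2 * t 1 1],
        ![s 1 0 * t 2 0 + s 2 0 * t 1 0, s 1 1 * t 2 1 + s 2 1 * t 1 1,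
          s 1 1 * t 2 2 + s 2 2 * t 1 1 + s 1 2 * t 2 1 + s 2 1 * t 1 2]] p q := by
  fin_cases p <;> fin_cases q <;> simp [Fin.sum_univ_three, mulDual] <;> ring

/-- With p, q the idempotents and x the nilpotent: Δ(p) and Δ(q) are idempotent and so have no
nilpotent part, while Δ(x)² = 0 leaves no scalar part in Δ(x) and forces lr = 0. The counit axioms
then give ε = (1, 0, 0), and coassociativity gives l² = l, r² = r and cl = cr. -/
theorem eq_dual (h : IsCompatible ⟨mulDual K, ![1, 1, 0], d, e⟩) :
    ∃ l r c : K, ((l = 1 ∧ r = 0 ∧ c = 0) ∨ (l = 0 ∧ r = 1 ∧ c = 0) ∨ (l = 0 ∧ r = 0)) ∧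
      (⟨mulDual K, ![1, 1, 0], d, e⟩ : StructureConstants K) = dual l r c := by
  have M := h.comul_mul
  simp only [mulDual_tmul] at M
  have M00 := fun p q => M 0 0 p q
  have M01 := fun p q => M 0 1 p q
  have M11 := fun p q => M 1 1 p q
  have M12 := fun p q => M 1 2 p q
  have M22 := fun p q => M 2 2 p q
  simp [Fin.sum_univ_three, mulDual, Fin.forall_fin_succ] at M00 M01 M11 M12 M22
  have L := fun k => h.counit_left 2 k
  have R := fun k => h.counit_right 2 k
  simp [Fin.sum_univ_three, Fin.forall_fin_succ] at L R
  have E := h.counit_mul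
  have E212 := E 2 1 2
  have E000 := E 0 0 0
  have E001 := E 0 0 1
  have E011 := E 0 1 1
  have E100 := E 1 0 0
  have E110 := E 1 1 0
  have E111 := E 1 1 1
  simp [Fin.sum_univ_three, mulDual] at E212 E000 E001 E011 E100 E110 E111
  obtain ⟨⟨i00, i01, n02⟩, ⟨i10, i11, n12⟩, n20, n21, n22⟩ := M00
  obtain ⟨⟨j00, j01, k02⟩, ⟨j10, j11, k12⟩, k20, k21, k22⟩ := M11
  obtain ⟨⟨o00, o01, -⟩, ⟨o10, o11, -⟩, -⟩ := M01
  obtain ⟨⟨x00, x01, -⟩, ⟨x10, x11, -⟩, -, -, x22⟩ := M22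
  obtain ⟨⟨-, -, y02⟩, ⟨-, -, y12⟩, y20, y21, y22⟩ := M12
  have n02 := eq_zero_of_eq_mul_add_mul i01 n02
  have n12 := eq_zero_of_eq_mul_add_mul i11 n12
  have n20 := eq_zero_of_eq_mul_add_mul i10 n20
  have n21 : d 0 2 1 = 0 := eq_zero_of_eq_mul_add_mul i11 n21
  rw [n12, n21, mul_zero, add_zero, add_zero] at n22
  have n22 := eq_zero_of_eq_mul_add_mul i11 n22
  have k02 := eq_zero_of_eq_mul_add_mul j01 k02
  have k12 := eq_zero_of_eq_mul_add_mul j11 k12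
  have k20 := eq_zero_of_eq_mul_add_mul j10 k20
  have k21 : d 1 2 1 = 0 := eq_zero_of_eq_mul_add_mul j11 k21
  rw [k12, k21, mul_zero, add_zero, add_zero] at k22
  have k22 := eq_zero_of_eq_mul_add_mul j11 k22
  simp only [x00, x01, x10, x11, n02, n12, n20, n21, n22, k02, k12, k20, k21, k22, mul_zero, zero_mul,
    add_zero, zero_add] at x22 y02 y12 y20 y21 y22 L R E212 E000 E011 E110
  -- The coefficient of x ⊗ x in Δ(x)² = 0.
  have hlr : d 2 1 2 * d 2 2 1 = 0 := by
    have : (2 : K) * (d 2 1 2 * d 2 2 1) = 0 := by linear_combination -x22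
    simpa using this
  obtain ⟨L0, L1, L2⟩ := L
  obtain ⟨R0, R1, R2⟩ := R
  -- The axiom for ε(xqx) = 0 reads `d 1 1 1` · ε(x)² = 0. If ε(x) ≠ 0, then Δ(x) loses the entries
  -- needed for the counit to recover x.
  have he2 : e 2 = 0 := by
    by_contra hne
    have h0 := E212.resolve_right hne
    rw [h0, zero_mul] at y22
    have h1 : d 2 0 2 = 0 := by simpa [hne] using R0
    have h2 : d 2 1 2 = 0 := by simpa [hne] using R1
    simp [h1, h2, y22] at L2
  simp only [he2, mul_zero, zero_mul, add_zero] at L2 R2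
  have he0 : e 0 ≠ 0 := by
    intro h0
    simp only [h0, zero_mul, zero_add] at L2 R2
    have h1 := right_ne_zero_of_mul_eq_one L2
    have h2 := right_ne_zero_of_mul_eq_one R2
    exact (mul_ne_zero h1 h2) hlr
  have ha : d 0 0 0 = 1 := by
    rcases eq_zero_or_one_of_eq_mul_self i00 with h0 | h0
    · rw [h0, zero_mul] at E000
      exact absurd E000 he0
    · exact h0
  have he0' : e 0 = 1 := by
    rw [ha, one_mul] at E000
    exact (eq_zero_or_one_of_eq_mul_self E000).resolve_left he0
  -- If ε(q) ≠ 0, the axiom for ε(pqq) and ε(qpp) removes the mixed entries of Δ(q), hence those of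
  -- Δ(x) involving p. The counit laws at x would then need both l and r nonzero, against `hlr`.
  have he1 : e 1 = 0 := by
    by_contra h1
    have t1 : d 1 0 1 = 0 := by simpa [he0', h1] using E011.symm
    have t2 : d 1 1 0 = 0 := by simpa [he0', h1] using E110.symm
    rw [t1, zero_mul] at y02
    rw [t2, zero_mul] at y20
    rw [y02, mul_zero, zero_add] at L2
    rw [y20, mul_zero, zero_add] at R2
    exact mul_ne_zero (right_ne_zero_of_mul_eq_one L2) (right_ne_zero_of_mul_eq_one R2) hlr
  simp only [he0', he1, one_mul, zero_mul, add_zero] at L2 R2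
  rw [L2, mul_one] at y02
  rw [R2, mul_one] at y20
  have c00 : d 1 0 0 = 0 := by simpa [ha] using o00
  have a01 : d 0 0 1 = 0 := by simpa [← y02] using o01
  have a10 : d 0 1 0 = 0 := by simpa [← y20] using o10
  have D := h.comul_one_left 1 0 1
  simp [Fin.sum_univ_three, comulOne, mulDual, ha, c00, a01, a10, ← y02, ← y20, x00, x10, x01] at D
  have C1 := h.coassoc 2 1 1 2
  have C2 := h.coassoc 2 2 1 1
  have C3 := h.coassoc 2 2 1 2
  simp [Fin.sum_univ_three, x00, x01, x10, x11, L2, R2, n12, n21, k12, k21] at C1 C2 C3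
  -- Otherwise the q ⊗ q entry of Δ(q) is 0, so l = 0, and the coassociativity equation `C1` reads 1
  -- = 0.
  have a11 : d 0 1 1 = 0 := by
    refine (eq_zero_or_one_of_eq_mul_self i11).resolve_right fun h1 => ?_
    have b11 : d 1 1 1 = 0 := by linear_combination D - h1
    rw [b11, zero_mul] at y12
    simp [h1, y12] at C1
  have b11 : d 1 1 1 = 1 := by linear_combination D - a11
  rw [a11, b11, mul_one, zero_add] at C1 C2
  have key : (⟨mulDual K, ![1, 1, 0], d, e⟩ : StructureConstants K) =
      dual (d 2 1 2) (d 2 2 1) (d 2 2 2) := by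
    apply eq_of_forall
    · intros; rfl
    · intros; rfl
    · intro i j k
      fin_cases i <;> fin_cases j <;> fin_cases k <;>
        simp [dual, x00, x01, x10, x11, n02, n12, n20, n21, n22, k02, k12, k20, k21, k22, ha, L2, R2,
          c00, a01, a10, a11, b11, ← y02, ← y20]
    · intro i
      fin_cases i <;> simp [dual, he0', he1, he2]
  refine ⟨_, _, _, ?_, key⟩
  rcases eq_zero_or_one_of_eq_mul_self C1 with hl | hl <;>
    rcases eq_zero_or_one_of_eq_mul_self C2.symm with hr | hr <;>
    simp [hl, hr] at hlr C3 ⊢ <;> exact C3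

end Dual
end StructureConstants

namespace WeakBialgebraData
open StructureConstants WeakBialgebraDimThree

theorem linearIndependent_triple_iff {K V : Type*} [Field K] [AddCommGroup V] [Module K V]
    {x y z : V} : LinearIndependent K ![x, y, z] ↔
      ∀ a b c : K, a • x + b • y + c • z = 0 → a = 0 ∧ b = 0 ∧ c = 0 := by
  rw [Fintype.linearIndependent_iff]
  simp only [Fin.sum_univ_three, Fin.forall_fin_succ, Matrix.cons_val]
  refine ⟨fun h a b c habc => ?_, fun h g hg => ?_⟩
  · simpa using h ![a, b, c] (by simpa using habc)
  · simpa using h _ _ _ hg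

/-- The basis given by three linearly independent vectors. -/
noncomputable def basisTriple {K V : Type*} [Field K] [AddCommGroup V] [Module K V]
    {x y z : V} (h : LinearIndependent K ![x, y, z]) (hV : Module.finrank K V = 3) :
    Module.Basis (Fin 3) K V :=
  basisOfLinearIndependentOfCardEqFinrank h (by simp [hV])

theorem coe_basisTriple {K V : Type*} [Field K] [AddCommGroup V] [Module K V]
    {x y z : V} (h : LinearIndependent K ![x, y, z]) (hV : Module.finrank K V = 3) :
    ⇑(basisTriple h hV) = ![x, y, z] := by
  simp [basisTriple]

/-- On triangular matrices these vectors multiply like the old ones for every `t`, so this is an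
algebra automorphism; on K × K[x]/(x²) only `t = 0` is used. -/
theorem exists_basis_shear {K V : Type*} [Field K] [AddCommGroup V] [Module K V]
    (b : Module.Basis (Fin 3) K V) (t : K) {c : K} (hc : c ≠ 0) :
    ∃ b' : Module.Basis (Fin 3) K V, ⇑b' = ![b 0 - t • b 2, b 1 + t • b 2, c • b 2] := by
  have hV : Module.finrank K V = 3 := by simp [Module.finrank_eq_card_basis b]
  have hb : LinearIndependent K ![b 0, b 1, b 2] := by
    convert b.linearIndependent
    ext i; fin_cases i <;> rfl
  have hli : LinearIndependent K ![b 0 - t • b 2, b 1 + t • b 2, c • b 2] := by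
    rw [linearIndependent_triple_iff] at hb ⊢
    intro α β γ h
    obtain ⟨rfl, rfl, h₃⟩ := hb α β (-α * t + β * t + γ * c) (by rw [← h]; module)
    simpa [hc] using h₃
  exact ⟨basisTriple hli hV, coe_basisTriple hli hV⟩

theorem HasConstants.exists_basis_dual {K V : Type*} [Field K] [AddCommGroup V] [Module K V]
    {B : WeakBialgebraData K V} {b : Module.Basis (Fin 3) K V} {c : K} (hc : c ≠ 0)
    (h : B.HasConstants b (dual 0 0 c)) :
    ∃ b' : Module.Basis (Fin 3) K V, B.HasConstants b' (dual 0 0 1) := by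
  -- With x' = cx the term c · c (x ⊗ x) of Δ(x') becomes x' ⊗ x'.
  obtain ⟨b', hb'⟩ := exists_basis_shear b 0 hc
  obtain ⟨hm, hu, hd, he⟩ := h
  refine ⟨b', fun i j => ?_, ?_, fun i => ?_, fun i => ?_⟩
  · fin_cases i <;> fin_cases j <;> simp [hb', Fin.sum_univ_three, dual, mulDual, hm]
  · simpa [hb', Fin.sum_univ_three, dual] using hu
  · fin_cases i <;> simp [hb', Fin.sum_univ_three, dual, hd, ← TensorProduct.smul_tmul',
      TensorProduct.tmul_smul]
  · fin_cases i <;> simp [hb', dual, he]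

theorem isomorphic_of_mulDual {V : Type*} [AddCommGroup V] [Module ℂ V]
    {B : WeakBialgebraData ℂ V} (hB : B.IsWeakBialgebra) {b : Module.Basis (Fin 3) ℂ V}
    {d : Fin 3 → Fin 3 → Fin 3 → ℂ} {e : Fin 3 → ℂ}
    (h : B.HasConstants b ⟨mulDual ℂ, ![1, 1, 0], d, e⟩) :
    ∃ i : Fin 20, B.Isomorphic (structures i) := by
  obtain ⟨l, r, c, hc, hT⟩ := eq_dual (h.isCompatible hB)
  rw [hT] at h
  rcases hc with ⟨rfl, rfl, rfl⟩ | ⟨rfl, rfl, rfl⟩ | ⟨rfl, rfl⟩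
  · exact ⟨_, h.isomorphic hasConstants_structures_11⟩
  · exact ⟨_, h.isomorphic hasConstants_structures_13⟩
  · by_cases hc : c = 0
    · rw [hc] at h
      exact ⟨_, h.isomorphic hasConstants_structures_14⟩
    · obtain ⟨b', h'⟩ := HasConstants.exists_basis_dual hc h
      exact ⟨_, h'.isomorphic hasConstants_structures_12⟩

end WeakBialgebraData

/-! ### The algebra of triangular matrices. -/

namespace StructureConstants

section Triangular

variable {K : Type*} [Field K] [CharZero K] {d : Fin 3 → Fin 3 → Fin 3 → K} {e : Fin 3 → K}

theorem mulTriangular_tmul (s t : Fin 3 → Fin 3 → K) (p q : Fin 3) :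
    ∑ a, ∑ b, ∑ c, ∑ f, s a b * t c f * (mulTriangular K a c p * mulTriangular K b f q) =
      ![![s 0 0 * t 0 0, s 0 1 * t 0 1, s 0 1 * t 0 2 + s 0 2 * t 0 0],
        ![s 1 0 * t 1 0, s 1 1 * t 1 1, s 1 1 * t 1 2 + s 1 2 * t 1 0],
        ![s 1 0 * t 2 0 + s 2 0 * t 0 0, s 1 1 * t 2 1 + s 2 1 * t 0 1,
          s 1 1 * t 2 2 + s 1 2 * t 2 0 + s 2 1 * t 0 2 + s 2 2 * t 0 0]] p q := by
  fin_cases p <;> fin_cases q <;> simp [Fin.sum_univ_three, mulTriangular] <;> ring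

theorem triangular_mul (h : IsCompatible ⟨mulTriangular K, ![1, 1, 0], d, e⟩) (i j p q : Fin 3) :
    ∑ a, mulTriangular K i j a * d a p q =
      ![![d i 0 0 * d j 0 0, d i 0 1 * d j 0 1, d i 0 1 * d j 0 2 + d i 0 2 * d j 0 0],
        ![d i 1 0 * d j 1 0, d i 1 1 * d j 1 1, d i 1 1 * d j 1 2 + d i 1 2 * d j 1 0],
        ![d i 1 0 * d j 2 0 + d i 2 0 * d j 0 0, d i 1 1 * d j 2 1 + d i 2 1 * d j 0 1,
          d i 1 1 * d j 2 2 + d i 1 2 * d j 2 0 + d i 2 1 * d j 0 2 + d i 2 2 * d j 0 0]] p q :=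
  (h.comul_mul i j p q).trans (mulTriangular_tmul (d i) (d j) p q)

theorem triangular_diag (h : IsCompatible ⟨mulTriangular K, ![1, 1, 0], d, e⟩) :
    d 2 0 0 = 0 ∧ d 2 0 1 = 0 ∧ d 2 1 0 = 0 ∧ d 2 1 1 = 0 := by
  have M := fun p q => triangular_mul h 2 2 p q
  simp [Fin.sum_univ_three, mulTriangular, Fin.forall_fin_succ] at M
  exact ⟨M.1.1, M.1.2.1, M.2.1.1, M.2.1.2.1⟩

/-- The normalisation of ε at q and x comes from `exists_basis_mulTriangular`. Since xpx = xqx = 0,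
weak multiplicativity of ε removes the p ⊗ q entries of Δ(p) and Δ(q); the remaining constants then
follow one at a time, with no parameter left. -/
theorem eq_arrow (h : IsCompatible ⟨mulTriangular K, ![1, 1, 0], d, e⟩) (h1 : e 1 = 1)
    (h2 : e 2 = 1) : (⟨mulTriangular K, ![1, 1, 0], d, e⟩ : StructureConstants K) = arrow K := by
  obtain ⟨x00, x01, x10, x11⟩ := triangular_diag h
  have M00 := fun p q => triangular_mul h 0 0 p q
  have M01 := fun p q => triangular_mul h 0 1 p q
  have M10 := fun p q => triangular_mul h 1 0 p q
  have M11 := fun p q => triangular_mul h 1 1 p q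
  have M12 := triangular_mul h 1 2 2 2
  have M20 := triangular_mul h 2 0 2 2
  simp [Fin.sum_univ_three, mulTriangular, Fin.forall_fin_succ] at M00 M01 M10 M11 M12 M20
  have L := h.counit_left
  have R := h.counit_right
  simp [Fin.sum_univ_three, Fin.forall_fin_succ, h1, h2] at L R
  have E0 := h.counit_mul 2 0 2
  have E1 := h.counit_mul 2 1 2
  simp [Fin.sum_univ_three, mulTriangular, h2] at E0 E1
  have C0 := h.coassoc 0 0 1 0
  have C1 := h.coassoc 1 1 0 1
  simp [Fin.sum_univ_three, x00, x01, x10, x11, E0, E1] at C0 C1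
  have D := h.comul_one_left 1 2 0
  simp [Fin.sum_univ_three, comulOne, mulTriangular] at D
  obtain ⟨⟨L00, -, -⟩, ⟨-, L11, L12⟩, L20, L21, L22⟩ := L
  obtain ⟨⟨R00, -, -⟩, ⟨-, R11, -⟩, R20, R21, -⟩ := R
  obtain ⟨-, ⟨-, -, n12⟩, -, n21, -⟩ := M00
  obtain ⟨⟨o00, -⟩, ⟨-, o11, -⟩, -⟩ := M01
  obtain ⟨-, -, -, -, n22⟩ := M10
  obtain ⟨⟨-, -, k02⟩, -, k20, -⟩ := M11
  have x20 : d 2 2 0 = 0 := by simpa [x00, x10] using L20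
  have x21 : d 2 2 1 = 0 := by simpa [x01, x11] using L21
  have x02 : d 2 0 2 = 0 := by simpa [x00, x01] using R20
  have x12 : d 2 1 2 = 0 := by simpa [x10, x11] using R21
  have x22 : d 2 2 2 = 1 := by simpa [x02, x12] using L22
  have a01 := E0.symm
  have b01 := E1.symm
  have b11 : d 1 1 1 = 1 := by simpa [x20, x02, x00, x22] using M12.symm
  have a00 : d 0 0 0 = 1 := by simpa [x11, x12, x21, x22] using M20.symm
  have a11 : d 0 1 1 = 0 := by simpa [b11] using o11
  have b00 : d 1 0 0 = 0 := by simpa [a00] using o00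
  have a10 : d 0 1 0 = 0 := by simpa [a00, a01, b01] using C0.symm
  have b10 : d 1 1 0 = 0 := by simpa [a01, b01, b11] using C1
  have k02 : d 1 0 2 = 0 := by simpa [b01, b00] using k02
  have k20 : d 1 2 0 = 0 := by simpa [b10, b00] using k20
  have k21 : d 1 2 1 = 0 := by simpa [b01, b11] using L11
  have k12 : d 1 1 2 = 0 := by simpa [b10, b11] using R11
  have k22 : d 1 2 2 = 0 := by simpa [k02, k12] using L12
  have n12 : d 0 1 2 = 0 := by simpa [a11, a10] using n12
  have n21 : d 0 2 1 = 0 := by simpa [a11, a01] using n21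
  have n22 : d 0 2 2 = 0 := by simpa [b11, k12, k21, k22] using n22.symm
  have n20 : d 0 2 0 = 0 := by
    simpa [n12, k12, x12, a11, b11, k20] using D.symm
  have e0 : e 0 = 1 := by simpa [a00, a10, n20] using L00
  have n02 : d 0 0 2 = 0 := by simpa [a00, a01, e0] using R00
  apply eq_of_forall
  · intros; rfl
  · intros; rfl
  · intro i j k
    fin_cases i <;> fin_cases j <;> fin_cases k <;>
      simp [arrow, x00, x01, x10, x11, x02, x12, x20, x21, x22, a00, a01, a10, a11, b00, b01, b10,
        b11, k02, k12, k20, k21, k22, n02, n12, n20, n21, n22]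
  · intro i
    fin_cases i <;> simp [arrow, e0, h1, h2]

/-- Exactly one of ε(p), ε(q) is nonzero and it equals 1; which one decides between the two
families. The free parameters are the x ⊗ x coefficients of Δ(q) and Δ(x). -/
theorem eq_triangular (h : IsCompatible ⟨mulTriangular K, ![1, 1, 0], d, e⟩) (h2 : e 2 = 0) :
    ∃ y c : K, (⟨mulTriangular K, ![1, 1, 0], d, e⟩ : StructureConstants K) = triangularLeft y c ∨
      (⟨mulTriangular K, ![1, 1, 0], d, e⟩ : StructureConstants K) = triangularRight y c := by
  obtain ⟨x00, x01, x10, x11⟩ := triangular_diag h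
  have M00 := fun p q => triangular_mul h 0 0 p q
  have M02 := fun p q => triangular_mul h 0 2 p q
  have M11 := fun p q => triangular_mul h 1 1 p q
  have M12 := triangular_mul h 1 2 0 2
  have M20 := triangular_mul h 2 0 1 2
  have M21 := fun p q => triangular_mul h 2 1 p q
  have M10 := triangular_mul h 1 0 2 2
  simp [Fin.sum_univ_three, mulTriangular, Fin.forall_fin_succ] at M00 M02 M11 M12 M20 M21 M10
  have L := h.counit_left
  have R := h.counit_right
  simp [Fin.sum_univ_three, Fin.forall_fin_succ, h2, x00, x01, x10, x11] at L R
  have E001 := h.counit_mul 0 0 1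
  have E011 := h.counit_mul 0 1 1
  have E100 := h.counit_mul 1 0 0
  have E110 := h.counit_mul 1 1 0
  simp [Fin.sum_univ_three, mulTriangular, h2] at E001 E011 E100 E110
  have C1 := h.coassoc 2 1 1 2
  have C0 := h.coassoc 2 0 0 2
  simp [Fin.sum_univ_three, x00, x01, x10, x11] at C0 C1
  have D0 := h.comul_one_left 0 1 0
  have D1 := h.comul_one_left 1 0 1
  simp [Fin.sum_univ_three, comulOne, mulTriangular, x00, x01, x10, x11] at D0 D1
  obtain ⟨⟨L00, L01, L02⟩, ⟨L10, L11, L12⟩, L22⟩ := L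
  obtain ⟨⟨R00, R01, R02⟩, ⟨R10, R11, R12⟩, R22⟩ := R
  obtain ⟨⟨i00, -, m02⟩, ⟨-, i11, m12⟩, m20, m21, -⟩ := M00
  obtain ⟨⟨-, -, p02⟩, ⟨-, -, p12⟩, p20, p21, -⟩ := M02
  obtain ⟨⟨j00, -, q02⟩, ⟨-, j11, q12⟩, q20, q21, -⟩ := M11
  obtain ⟨⟨-, -, r02⟩, ⟨-, -, r12⟩, r20, r21, -⟩ := M21
  by_cases he1 : e 1 = 0
  · simp only [he1, zero_mul, add_zero] at L00 L01 L02 L10 L11 L12 L22 R00 R01 R02 R10 R11 R12 R22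
    have he0 : e 0 ≠ 0 := left_ne_zero_of_mul_eq_one L00
    have a00 : d 0 0 0 = 1 := (eq_zero_or_one_of_eq_mul_self i00).resolve_left
      (right_ne_zero_of_mul_eq_one L00)
    have e0 : e 0 = 1 := by simpa [a00] using L00
    simp only [e0, one_mul] at L00 L01 L02 L10 L11 L12 L22 R00 R01 R02 R10 R11 R12 R22
    have x12 : d 2 1 2 = 0 := by simpa [x11, R11] using r12.symm
    have x21 : d 2 2 1 = 0 := by simpa [x11, L11] using r21.symm
    have a11 : d 0 1 1 = 0 := by simpa [x12, L22] using C1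
    have b11 : d 1 1 1 = 1 := by simpa [L11, L01, R01, R11, a11] using D1
    have k12 : d 1 1 2 = 0 := by simpa [R11, b11] using q12
    have k21 : d 1 2 1 = 0 := by simpa [L11, b11] using q21
    have n12 : d 0 1 2 = 0 := by simpa [a11, R01] using m12
    have n21 : d 0 2 1 = 0 := by simpa [a11, L01] using m21
    have n22 : d 0 2 2 = -d 1 2 2 := by
      simp only [b11, k12, k21, a00] at M10
      linear_combination -M10
    refine ⟨d 1 2 2, d 2 2 2, .inl (eq_of_forall (fun _ _ _ => rfl) (fun _ => rfl) ?_ ?_)⟩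
    · intro i j k
      fin_cases i <;> fin_cases j <;> fin_cases k <;>
        simp [triangularLeft, x00, x01, x10, x11, x12, x21, a00, a11, b11, k12, k21, n12, n21, n22,
          L01, L02, L10, L11, L12, L22, R01, R02, R11, R12, R22]
    · intro i
      fin_cases i <;> simp [triangularLeft, e0, he1, h2]
  -- If both were nonzero, the axiom for ε(qpp) = ε(pqq) = 0 would remove entries of Δ(p) and Δ(q),
  -- and by multiplicativity the p ⊗ x and q ⊗ x entries of Δ(x), against the counit law at x.
  · have he0 : e 0 = 0 := by
      by_contra he0
      have a10 : d 0 1 0 = 0 := by simpa [he0, he1] using E100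
      have b01 : d 1 0 1 = 0 := by simpa [he0, he1] using E011
      have x02 : d 2 0 2 = 0 := by simpa [b01, x00] using M12
      have x12 : d 2 1 2 = 0 := by simpa [a10, x11] using M20
      simp [x02, x12] at L22
    simp only [he0, zero_mul, zero_add] at L00 L01 L02 L10 L11 L12 L22 R00 R01 R02 R10 R11 R12 R22
    have b11 : d 1 1 1 = 1 := (eq_zero_or_one_of_eq_mul_self j11).resolve_left
      (right_ne_zero_of_mul_eq_one L11)
    have e1 : e 1 = 1 := by simpa [b11] using L11
    simp only [e1, one_mul] at L00 L01 L02 L10 L11 L12 L22 R00 R01 R02 R10 R11 R12 R22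
    have x02 : d 2 0 2 = 0 := by simpa [x00, R00] using p02.symm
    have x20 : d 2 2 0 = 0 := by simpa [x00, L00] using p20.symm
    have b00 : d 1 0 0 = 0 := by simpa [x02, L22] using C0
    have a00 : d 0 0 0 = 1 := by simpa [L00, L10, R00, R10, b00] using D0
    have n02 : d 0 0 2 = 0 := by simpa [R00, a00] using m02
    have n20 : d 0 2 0 = 0 := by simpa [L00, a00] using m20
    have k02 : d 1 0 2 = 0 := by simpa [b00, R10] using q02
    have k20 : d 1 2 0 = 0 := by simpa [b00, L10] using q20
    have n22 : d 0 2 2 = -d 1 2 2 := by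
      simp only [b11, L12, R12, a00] at M10
      linear_combination -M10
    refine ⟨d 1 2 2, d 2 2 2, .inr (eq_of_forall (fun _ _ _ => rfl) (fun _ => rfl) ?_ ?_)⟩
    · intro i j k
      fin_cases i <;> fin_cases j <;> fin_cases k <;>
        simp [triangularRight, x00, x01, x10, x11, x02, x20, a00, b11, b00, n02, n20, k02, k20, n22,
          L00, L01, L02, L10, L11, L12, L22, R00, R01, R02, R10, R11, R12, R22]
    · intro i
      fin_cases i <;> simp [triangularRight, e1, he0, h2]

end Triangular
end StructureConstants

namespace WeakBialgebraData
open StructureConstants WeakBialgebraDimThree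

variable {K V : Type*} [Field K] [AddCommGroup V] [Module K V]

/-- The two conditions compare the x ⊗ x coefficients of Δ(p - tx) and Δ(lx) with the old ones. The
quantity y - c²/4 is thus an invariant up to squares; for the other family it is y + c²/4. -/
theorem HasConstants.exists_basis_triangularLeft {B : WeakBialgebraData K V}
    {b : Module.Basis (Fin 3) K V} {y c t l y' c' : K} (h : B.HasConstants b (triangularLeft y c))
    (hl : l ≠ 0) (hy : y + t * c + t ^ 2 = y' * l ^ 2) (hc : c + 2 * t = c' * l) :
    ∃ b' : Module.Basis (Fin 3) K V, B.HasConstants b' (triangularLeft y' c') := by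
  obtain ⟨b', hb'⟩ := exists_basis_shear b t hl
  obtain ⟨hm, hu, hd, he⟩ := h
  obtain rfl : y = y' * l ^ 2 - t * c - t ^ 2 := by linear_combination hy
  obtain rfl : c = c' * l - 2 * t := by linear_combination hc
  refine ⟨b', fun i j => ?_, ?_, fun i => ?_, fun i => ?_⟩
  · fin_cases i <;> fin_cases j <;>
      simp [hb', Fin.sum_univ_three, triangularLeft, mulTriangular, hm]
  · simpa [hb', Fin.sum_univ_three, triangularLeft] using hu
  · fin_cases i <;> simp [hb', Fin.sum_univ_three, triangularLeft, hd, TensorProduct.add_tmul,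
      TensorProduct.sub_tmul, TensorProduct.tmul_add, TensorProduct.tmul_sub,
      ← TensorProduct.smul_tmul', TensorProduct.tmul_smul] <;> module
  · fin_cases i <;> simp [hb', triangularLeft, he]

theorem HasConstants.exists_basis_triangularRight {B : WeakBialgebraData K V}
    {b : Module.Basis (Fin 3) K V} {y c t l y' c' : K} (h : B.HasConstants b (triangularRight y c))
    (hl : l ≠ 0) (hy : y + t * c - t ^ 2 = y' * l ^ 2) (hc : c - 2 * t = c' * l) :
    ∃ b' : Module.Basis (Fin 3) K V, B.HasConstants b' (triangularRight y' c') := by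
  obtain ⟨b', hb'⟩ := exists_basis_shear b t hl
  obtain ⟨hm, hu, hd, he⟩ := h
  obtain rfl : y = y' * l ^ 2 - t * c + t ^ 2 := by linear_combination hy
  obtain rfl : c = c' * l + 2 * t := by linear_combination hc
  refine ⟨b', fun i j => ?_, ?_, fun i => ?_, fun i => ?_⟩
  · fin_cases i <;> fin_cases j <;>
      simp [hb', Fin.sum_univ_three, triangularRight, mulTriangular, hm]
  · simpa [hb', Fin.sum_univ_three, triangularRight] using hu
  · fin_cases i <;> simp [hb', Fin.sum_univ_three, triangularRight, hd, TensorProduct.add_tmul,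
      TensorProduct.sub_tmul, TensorProduct.tmul_add, TensorProduct.tmul_sub,
      ← TensorProduct.smul_tmul', TensorProduct.tmul_smul] <;> module
  · fin_cases i <;> simp [hb', triangularRight, he]

theorem HasConstants.exists_basis_mulTriangular {B : WeakBialgebraData K V}
    {b : Module.Basis (Fin 3) K V} {d : Fin 3 → Fin 3 → Fin 3 → K} {e : Fin 3 → K}
    (h : B.HasConstants b ⟨mulTriangular K, ![1, 1, 0], d, e⟩) (he : e 2 ≠ 0) :
    ∃ (b' : Module.Basis (Fin 3) K V) (d' : Fin 3 → Fin 3 → Fin 3 → K) (e' : Fin 3 → K),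
      B.HasConstants b' ⟨mulTriangular K, ![1, 1, 0], d', e'⟩ ∧ e' 1 = 1 ∧ e' 2 = 1 := by
  -- The shear is chosen so that ε(q + tx) = 1, the scaling so that ε takes the value 1 on the new
  -- x.
  obtain ⟨b', hb'⟩ := exists_basis_shear b ((1 - e 1) * (e 2)⁻¹) (inv_ne_zero he)
  obtain ⟨hm, hu, -, hc⟩ := h
  obtain ⟨d', e', h'⟩ := B.exists_hasConstants b' (mulTriangular K) ![1, 1, 0]
    (fun i j => by
      fin_cases i <;> fin_cases j <;> simp [hb', Fin.sum_univ_three, mulTriangular, hm])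
    (by simpa [hb', Fin.sum_univ_three] using hu)
  refine ⟨b', d', e', h', ?_, ?_⟩
  · exact (h'.counit 1).symm.trans (by simp [hb', hc, he])
  · exact (h'.counit 2).symm.trans (by simp [hb', hc, he])

theorem isomorphic_of_mulTriangular {V : Type*} [AddCommGroup V] [Module ℂ V]
    {B : WeakBialgebraData ℂ V} (hB : B.IsWeakBialgebra) {b : Module.Basis (Fin 3) ℂ V}
    {d : Fin 3 → Fin 3 → Fin 3 → ℂ} {e : Fin 3 → ℂ}
    (h : B.HasConstants b ⟨mulTriangular ℂ, ![1, 1, 0], d, e⟩) :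
    ∃ i : Fin 20, B.Isomorphic (structures i) := by
  by_cases he : e 2 = 0
  · obtain ⟨y, c, hT | hT⟩ := eq_triangular (h.isCompatible hB) he <;> rw [hT] at h
    -- The shear by t = -c/2 completes the square and removes c. The invariant that remains is
    -- either 0 or, by a square root, scaled to -1.
    · by_cases hy : y - c ^ 2 / 4 = 0
      · obtain ⟨b', h'⟩ := h.exists_basis_triangularLeft (t := -c / 2) (y' := 0) (c' := 0)
          one_ne_zero (by linear_combination hy) (by ring)
        exact ⟨_, h'.isomorphic hasConstants_structures_16⟩
      · obtain ⟨l, hl⟩ := IsAlgClosed.exists_pow_nat_eq (-(y - c ^ 2 / 4)) two_pos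
        have hl0 : l ≠ 0 := by
          rintro rfl
          exact hy (by linear_combination hl)
        obtain ⟨b', h'⟩ := h.exists_basis_triangularLeft (t := -c / 2) (y' := -1) (c' := 0)
          hl0 (by linear_combination hl) (by ring)
        exact ⟨_, h'.isomorphic hasConstants_structures_17⟩
    · by_cases hy : y + c ^ 2 / 4 = 0
      · obtain ⟨b', h'⟩ := h.exists_basis_triangularRight (t := c / 2) (y' := 0) (c' := 0)
          one_ne_zero (by linear_combination hy) (by ring)
        exact ⟨_, h'.isomorphic hasConstants_structures_18⟩
      · obtain ⟨l, hl⟩ := IsAlgClosed.exists_pow_nat_eq (y + c ^ 2 / 4) two_pos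
        have hl0 : l ≠ 0 := by
          rintro rfl
          exact hy (by linear_combination -hl)
        obtain ⟨b', h'⟩ := h.exists_basis_triangularRight (t := c / 2) (y' := 1) (c' := 0)
          hl0 (by linear_combination -hl) (by ring)
        exact ⟨_, h'.isomorphic hasConstants_structures_19⟩
  · obtain ⟨b', d', e', h', h1, h2⟩ := h.exists_basis_mulTriangular he
    rw [eq_arrow (h'.isCompatible hB) h1 h2] at h'
    exact ⟨_, h'.isomorphic hasConstants_structures_15⟩

end WeakBialgebraData

/-! ### The local algebras carry no structure. -/

namespace StructureConstants

/-- Multiplication constants of the local algebra with basis `1, x, y`, where `x² = s y` and all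
other products of `x` and `y` vanish. -/
def mulLocal {R : Type*} [CommRing R] (s : R) : Fin 3 → Fin 3 → Fin 3 → R :=
  ![![![1, 0, 0], ![0, 1, 0], ![0, 0, 1]],
    ![![0, 1, 0], ![0, 0, s], ![0, 0, 0]],
    ![![0, 0, 1], ![0, 0, 0], ![0, 0, 0]]]

variable {K : Type*} [Field K] [CharZero K] {d : Fin 3 → Fin 3 → Fin 3 → K} {e : Fin 3 → K}

/-- Δ(1) is an idempotent of a local algebra, nonzero by the counit law. Its coefficients are
removed in an order compatible with the radical filtration, each step reusing the idempotent scalar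
part. -/
theorem mulLocal_comul_one {s : K} (h : IsCompatible ⟨mulLocal s, ![1, 0, 0], d, e⟩) (p q : Fin 3) :
    d 0 p q = if p = 0 ∧ q = 0 then 1 else 0 := by
  have M := fun p q => h.comul_mul 0 0 p q
  have L := h.counit_left 0 0
  simp [Fin.sum_univ_three, mulLocal, Fin.forall_fin_succ] at M L
  obtain ⟨⟨h00, h01, h02⟩, ⟨h10, h11, h12⟩, h20, h21, h22⟩ := M
  have h01 : d 0 0 1 = 0 := eq_zero_of_eq_mul_add_mul h00 (by linear_combination h01)
  have h10 : d 0 1 0 = 0 := eq_zero_of_eq_mul_add_mul h00 (by linear_combination h10)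
  simp only [h01, h10, mul_zero, zero_mul, add_zero, zero_add] at h02 h11 h12 h20 h21 h22
  have h02 : d 0 0 2 = 0 := eq_zero_of_eq_mul_add_mul h00 (by linear_combination h02)
  have h20 : d 0 2 0 = 0 := eq_zero_of_eq_mul_add_mul h00 (by linear_combination h20)
  have h11 : d 0 1 1 = 0 := eq_zero_of_eq_mul_add_mul h00 (by linear_combination h11)
  simp only [h02, h20, h11, mul_zero, zero_mul, add_zero, zero_add] at h12 h21 h22
  have h12 : d 0 1 2 = 0 := eq_zero_of_eq_mul_add_mul h00 (by linear_combination h12)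
  have h21 : d 0 2 1 = 0 := eq_zero_of_eq_mul_add_mul h00 (by linear_combination h21)
  have h22 : d 0 2 2 = 0 := eq_zero_of_eq_mul_add_mul h00 (by linear_combination h22)
  have h00 : d 0 0 0 = 1 := (eq_zero_or_one_of_eq_mul_self h00).resolve_left fun h0 => by
    simp [h0, h10, h20] at L
  fin_cases p <;> fin_cases q <;> simp [h00, h01, h02, h10, h11, h12, h20, h21, h22]

/-- As Δ(1) = 1 ⊗ 1, ε is multiplicative and vanishes on the nilpotents, so Δ(x) and Δ(y) are
primitive up to terms in radical ⊗ radical. -/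
theorem not_isCompatible_mulLocal (s : K) : ¬ IsCompatible ⟨mulLocal s, ![1, 0, 0], d, e⟩ := by
  intro h
  have D := mulLocal_comul_one h
  have L := h.counit_left
  have R := h.counit_right
  have e0 := h.counit_left 0 0
  have E1 := h.counit_mul 1 0 1
  have E2 := h.counit_mul 2 0 2
  simp [Fin.sum_univ_three, mulLocal, D] at e0 E1 E2
  rw [E2] at E1
  have e1 : e 1 = 0 := by simpa using E1
  simp [Fin.sum_univ_three, Fin.forall_fin_succ, e0, e1, E2] at L R
  -- The x ⊗ x coefficient of Δ(x)² = sΔ(y) gives 2 = s · `d 2 1 1`; the y ⊗ x coefficient of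
  -- Δ(x)Δ(y) = 0 gives 1 + s · `d 2 1 1` = 0.
  have M11 := h.comul_mul 1 1 1 1
  have M12 := h.comul_mul 1 2 2 1
  simp [Fin.sum_univ_three, mulLocal, L, R] at M11 M12
  have : (3 : K) = 0 := by linear_combination -M12 - M11
  norm_num at this

end StructureConstants

/-! ### Classification of the three-dimensional algebras. -/

namespace AlgebraDimThree
open StructureConstants WeakBialgebraData

variable {K A : Type*} [Field K] [Ring A] [Algebra K A]

/-- The algebra `A` has multiplication constants `m` and unit `u` in the basis `b`. -/
def HasTable (b : Module.Basis (Fin 3) K A) (m : Fin 3 → Fin 3 → Fin 3 → K) (u : Fin 3 → K) : Prop :=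
  (∀ i j, b i * b j = ∑ k, m i j k • b k) ∧ 1 = ∑ k, u k • b k

theorem exists_mulDiag (hA : Module.finrank K A = 3) {p q r : A} (hp : p ≠ 0) (hq : q ≠ 0)
    (hr : r ≠ 0) (hpp : p * p = p) (hqq : q * q = q) (hrr : r * r = r) (hpq : p * q = 0)
    (hqp : q * p = 0) (hpr : p * r = 0) (hrp : r * p = 0) (hqr : q * r = 0) (hrq : r * q = 0) :
    ∃ b : Module.Basis (Fin 3) K A, HasTable b (mulDiag K) 1 := by
  have hli : LinearIndependent K ![p, q, r] := by
    rw [linearIndependent_triple_iff]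
    intro α β γ h
    have h₁ := congrArg (p * ·) h
    have h₂ := congrArg (q * ·) h
    have h₃ := congrArg (r * ·) h
    simp [mul_add, hpp, hqq, hrr, hpq, hqp, hpr, hrp, hqr, hrq, hp, hq, hr] at h₁ h₂ h₃
    exact ⟨h₁, h₂, h₃⟩
  have hb := coe_basisTriple hli hA
  refine ⟨basisTriple hli hA, fun i j => ?_, ?_⟩
  · rw [hb]
    fin_cases i <;> fin_cases j <;> simp [mulDiag, Fin.sum_univ_three, *]
  -- That p + q + r = 1 is not assumed: multiplying the expansion of 1 by each idempotent shows that
  -- its coefficients are all 1.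
  · have h := (basisTriple hli hA).sum_repr 1
    simp only [hb, Fin.sum_univ_three, Matrix.cons_val] at h
    have h₁ := congrArg (p * ·) h
    have h₂ := congrArg (q * ·) h
    have h₃ := congrArg (r * ·) h
    simp [mul_add, hpp, hqq, hrr, hpq, hqp, hpr, hrp, hqr, hrq] at h₁ h₂ h₃
    rw [h₁, h₂, h₃] at h
    rw [hb]
    simp [Fin.sum_univ_three, h]

theorem exists_mulDual (hA : Module.finrank K A = 3) {p x : A} (hp : p ≠ 0) (hx : x ≠ 0)
    (hpp : p * p = p) (hpx : p * x = 0) (hxp : x * p = 0) (hxx : x * x = 0) :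
    ∃ b : Module.Basis (Fin 3) K A, HasTable b (mulDual K) ![1, 1, 0] := by
  have hli : LinearIndependent K ![p, 1 - p, x] := by
    rw [linearIndependent_triple_iff]
    intro α β γ h
    have h₁ := congrArg (p * ·) h
    have h₂ := congrArg (x * ·) h
    simp [mul_add, mul_sub, hpp, hpx, hxp, hxx, hp, hx] at h₁ h₂
    simpa [h₁, h₂, hx] using h
  have hb := coe_basisTriple hli hA
  refine ⟨basisTriple hli hA, fun i j => ?_, ?_⟩
  · rw [hb]
    fin_cases i <;> fin_cases j <;>
      simp [mulDual, Fin.sum_univ_three, mul_sub, sub_mul, hpp, hpx, hxp, hxx]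
  · rw [hb]
    simp [Fin.sum_univ_three]

/-- As y is an involution, (1 ± y)/2 are orthogonal idempotents, and x carries the first to the
second. -/
theorem exists_mulTriangular [CharZero K] (hA : Module.finrank K A = 3) {x y : A}
    (hli : LinearIndependent K ![1, x, y]) (hxx : x * x = 0) (hxy : x * y = x) (hyx : y * x = -x)
    (hyy : y * y = 1) :
    ∃ b : Module.Basis (Fin 3) K A, HasTable b (mulTriangular K) ![1, 1, 0] := by
  have hli : LinearIndependent K ![(2⁻¹ : K) • (1 + y), (2⁻¹ : K) • (1 - y), x] := by
    rw [linearIndependent_triple_iff] at hli ⊢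
    intro α β γ h
    obtain ⟨h₁, h₂, h₃⟩ := hli (2⁻¹ * (α + β)) γ (2⁻¹ * (α - β)) (by rw [← h]; module)
    refine ⟨?_, ?_, h₂⟩
    · linear_combination h₁ + h₃
    · linear_combination h₁ - h₃
  have hb := coe_basisTriple hli hA
  refine ⟨basisTriple hli hA, fun i j => ?_, ?_⟩
  · rw [hb]
    fin_cases i <;> fin_cases j <;>
      simp [mulTriangular, Fin.sum_univ_three, mul_sub, sub_mul, mul_add, add_mul, hxx, hxy, hyx,
        hyy] <;> module
  · rw [hb]
    simp [Fin.sum_univ_three]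
    module

theorem exists_mulLocal (hA : Module.finrank K A = 3) (s : K) {x y : A}
    (hli : LinearIndependent K ![1, x, y]) (hxx : x * x = s • y) (hxy : x * y = 0)
    (hyx : y * x = 0) (hyy : y * y = 0) :
    ∃ b : Module.Basis (Fin 3) K A, HasTable b (mulLocal s) ![1, 0, 0] := by
  have hb := coe_basisTriple hli hA
  refine ⟨basisTriple hli hA, fun i j => ?_, ?_⟩
  · rw [hb]
    fin_cases i <;> fin_cases j <;> simp [mulLocal, Fin.sum_univ_three, *]
  · rw [hb]
    simp [Fin.sum_univ_three]

/-- The tables which occur among the three-dimensional algebras. -/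
def IsStandard (K A : Type*) [Field K] [Ring A] [Algebra K A] : Prop :=
  ∃ b : Module.Basis (Fin 3) K A, HasTable b (mulDiag K) 1 ∨ HasTable b (mulDual K) ![1, 1, 0] ∨
    HasTable b (mulTriangular K) ![1, 1, 0] ∨ ∃ s, HasTable b (mulLocal s) ![1, 0, 0]

theorem exists_cubic_roots [IsAlgClosed K] [CharZero K] (c₀ c₁ c₂ : K) :
    ∃ r s t : K, c₂ = r + s + t ∧ c₁ = -(r * s + r * t + s * t) ∧ c₀ = r * s * t := by
  open Polynomial in
  obtain ⟨r, hr⟩ := IsAlgClosed.exists_root (X ^ 3 - C c₂ * X ^ 2 - C c₁ * X - C c₀ : K[X]) (by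
    have : (X ^ 3 - C c₂ * X ^ 2 - C c₁ * X - C c₀ : K[X]).degree = 3 := by compute_degree!
    rw [this]; norm_num)
  simp at hr
  -- A square root of the discriminant of the quadratic left after dividing the cubic by X - r.
  obtain ⟨δ, hδ⟩ := IsAlgClosed.exists_pow_nat_eq ((c₂ - r) ^ 2 + 4 * (c₁ + r * (c₂ - r))) two_pos
  refine ⟨r, (c₂ - r + δ) / 2, (c₂ - r - δ) / 2, by ring, ?_, ?_⟩
  · linear_combination (-1 / 4) * hδ
  · linear_combination (r / 4) * hδ - hr

theorem quadratic_mul_quadratic {a : A} {r s t : K}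
    (ha : a * (a * a) = (r + s + t) • (a * a) - (r * s + r * t + s * t) • a + (r * s * t) • 1)
    (α β γ α' β' γ' : K) :
    (α • 1 + β • a + γ • (a * a)) * (α' • 1 + β' • a + γ' • (a * a)) =
      (α * α' + (β * γ' + γ * β') * (r * s * t) + γ * γ' * (r + s + t) * (r * s * t)) • (1 : A) +
      (α * β' + β * α' - (β * γ' + γ * β') * (r * s + r * t + s * t) +
        γ * γ' * (r * s * t - (r + s + t) * (r * s + r * t + s * t))) • a +
      (α * γ' + γ * α' + β * β' + (β * γ' + γ * β') * (r + s + t) +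
        γ * γ' * ((r + s + t) ^ 2 - (r * s + r * t + s * t))) • (a * a) := by
  simp only [mul_add, mul_sub, add_mul, smul_mul_assoc, mul_smul_comm, mul_one, one_mul, mul_assoc, ha]
  module

theorem exists_mulDiag_of_cubic (hA : Module.finrank K A = 3) {a : A} {r s t : K}
    (hli : LinearIndependent K ![1, a, a * a])
    (ha : a * (a * a) = (r + s + t) • (a * a) - (r * s + r * t + s * t) • a + (r * s * t) • 1)
    (hrs : r ≠ s) (hrt : r ≠ t) (hst : s ≠ t) :
    ∃ b : Module.Basis (Fin 3) K A, HasTable b (mulDiag K) 1 := by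
  have mul := quadratic_mul_quadratic ha
  rw [linearIndependent_triple_iff] at hli
  obtain ⟨u, hu⟩ : ∃ u, u * ((r - s) * (r - t)) = 1 :=
    ⟨_, inv_mul_cancel₀ (mul_ne_zero (sub_ne_zero.2 hrs) (sub_ne_zero.2 hrt))⟩
  obtain ⟨v, hv⟩ : ∃ v, v * ((s - r) * (s - t)) = 1 :=
    ⟨_, inv_mul_cancel₀ (mul_ne_zero (sub_ne_zero.2 hrs.symm) (sub_ne_zero.2 hst))⟩
  obtain ⟨w, hw⟩ : ∃ w, w * ((t - r) * (t - s)) = 1 :=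
    ⟨_, inv_mul_cancel₀ (mul_ne_zero (sub_ne_zero.2 hrt.symm) (sub_ne_zero.2 hst.symm))⟩
  -- Lagrange interpolation idempotents, such as (a - s)(a - t)/((r - s)(r - t)).
  refine exists_mulDiag hA (p := (u * s * t) • 1 + (-u * (s + t)) • a + u • (a * a))
    (q := (v * r * t) • 1 + (-v * (r + t)) • a + v • (a * a))
    (r := (w * r * s) • 1 + (-w * (r + s)) • a + w • (a * a))
    (fun h => left_ne_zero_of_mul_eq_one hu (hli _ _ _ h).2.2)
    (fun h => left_ne_zero_of_mul_eq_one hv (hli _ _ _ h).2.2)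
    (fun h => left_ne_zero_of_mul_eq_one hw (hli _ _ _ h).2.2) ?_ ?_ ?_ ?_ ?_ ?_ ?_ ?_ ?_
  · rw [mul]
    congr 2
    · congr 1
      linear_combination (u * s * t) * hu
    · congr 1
      linear_combination (-u * (s + t)) * hu
    · linear_combination u * hu
  · rw [mul]
    congr 2
    · congr 1
      linear_combination (v * r * t) * hv
    · congr 1
      linear_combination (-v * (r + t)) * hv
    · linear_combination v * hv
  · rw [mul]
    congr 2
    · congr 1
      linear_combination (w * r * s) * hw
    · congr 1
      linear_combination (-w * (r + s)) * hw
    · linear_combination w * hw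
  all_goals
    rw [mul]
    module

theorem exists_mulDual_of_cubic (hA : Module.finrank K A = 3) {a : A} {r t : K}
    (hli : LinearIndependent K ![1, a, a * a])
    (ha : a * (a * a) = (r + r + t) • (a * a) - (r * r + r * t + r * t) • a + (r * r * t) • 1)
    (hrt : r ≠ t) :
    ∃ b : Module.Basis (Fin 3) K A, HasTable b (mulDual K) ![1, 1, 0] := by
  have mul := quadratic_mul_quadratic ha
  rw [linearIndependent_triple_iff] at hli
  obtain ⟨w, hw⟩ : ∃ w, w * ((t - r) * (t - r)) = 1 :=
    ⟨_, inv_mul_cancel₀ (mul_ne_zero (sub_ne_zero.2 hrt.symm) (sub_ne_zero.2 hrt.symm))⟩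
  -- The idempotent (a - r)²/(t - r)² of the simple root and the nilpotent (a - r)(a - t).
  refine exists_mulDual hA (p := (w * r * r) • 1 + (-w * (r + r)) • a + w • (a * a))
    (x := (r * t) • 1 + (-(r + t)) • a + (1 : K) • (a * a))
    (fun h => left_ne_zero_of_mul_eq_one hw (hli _ _ _ h).2.2)
    (fun h => one_ne_zero (hli _ _ _ h).2.2) ?_ ?_ ?_ ?_
  · rw [mul]
    congr 2
    · congr 1
      linear_combination (w * r * r) * hw
    · congr 1
      linear_combination (-w * (r + r)) * hw
    · linear_combination w * hw
  all_goals
    rw [mul]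
    module

theorem exists_mulLocal_of_cubic (hA : Module.finrank K A = 3) {a : A} {r : K}
    (hli : LinearIndependent K ![1, a, a * a])
    (ha : a * (a * a) = (r + r + r) • (a * a) - (r * r + r * r + r * r) • a + (r * r * r) • 1) :
    ∃ b : Module.Basis (Fin 3) K A, HasTable b (mulLocal 1) ![1, 0, 0] := by
  have mul := quadratic_mul_quadratic ha
  -- Here x = a - r and y = (a - r)².
  refine exists_mulLocal hA 1 (x := (-r) • 1 + (1 : K) • a + (0 : K) • (a * a))
    (y := (r * r) • 1 + (-(r + r)) • a + (1 : K) • (a * a)) ?_ ?_ ?_ ?_ ?_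
  · rw [linearIndependent_triple_iff] at hli ⊢
    intro α β γ h
    obtain ⟨h₁, h₂, rfl⟩ := hli (α - β * r + γ * (r * r)) (β - γ * (r + r)) γ (by rw [← h]; module)
    obtain rfl : β = 0 := by simpa using h₂
    simpa using h₁
  all_goals
    rw [mul]
    module

theorem isStandard_of_linearIndependent [IsAlgClosed K] [CharZero K]
    (hA : Module.finrank K A = 3) {a : A} (hli : LinearIndependent K ![1, a, a * a]) :
    IsStandard K A := by
  have h := (basisTriple hli hA).sum_repr (a * (a * a))
  simp only [coe_basisTriple, Fin.sum_univ_three, Matrix.cons_val] at h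
  obtain ⟨r, s, t, h₂, h₁, h₀⟩ := exists_cubic_roots ((basisTriple hli hA).repr (a * (a * a)) 0)
    ((basisTriple hli hA).repr (a * (a * a)) 1) ((basisTriple hli hA).repr (a * (a * a)) 2)
  rw [h₀, h₁, h₂] at h
  by_cases hrs : r = s
  · by_cases hrt : r = t
    · subst hrs hrt
      obtain ⟨b, hb⟩ := exists_mulLocal_of_cubic hA hli (by rw [← h]; module)
      exact ⟨b, .inr (.inr (.inr ⟨_, hb⟩))⟩
    · subst hrs
      obtain ⟨b, hb⟩ := exists_mulDual_of_cubic hA hli (by rw [← h]; module) hrt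
      exact ⟨b, .inr (.inl hb)⟩
  · by_cases hrt : r = t
    · subst hrt
      obtain ⟨b, hb⟩ := exists_mulDual_of_cubic hA hli (by rw [← h]; module) hrs
      exact ⟨b, .inr (.inl hb)⟩
    · by_cases hst : s = t
      · subst hst
        obtain ⟨b, hb⟩ := exists_mulDual_of_cubic hA hli (by rw [← h]; module) (Ne.symm hrs)
        exact ⟨b, .inr (.inl hb)⟩
      · obtain ⟨b, hb⟩ := exists_mulDiag_of_cubic hA hli (by rw [← h]; module) hrs hrt hst
        exact ⟨b, .inl hb⟩

theorem exists_linearIndependent_one (hA : Module.finrank K A = 3) :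
    ∃ x y : A, LinearIndependent K ![1, x, y] := by
  have : Nontrivial A := Module.nontrivial_of_finrank_pos (R := K) (by omega)
  have h₁ : LinearIndependent K ![(1 : A)] := by simp
  obtain ⟨x, hx⟩ : ∃ x, x ∉ Submodule.span K (Set.range ![(1 : A)]) := by
    by_contra! h
    have := finrank_range_le_card (R := K) ![(1 : A)]
    rw [Set.finrank, (Submodule.eq_top_iff'.2 h), finrank_top, hA] at this
    simp at this
  have h₂ : LinearIndependent K ![x, 1] := linearIndependent_finCons.2 ⟨h₁, hx⟩
  obtain ⟨y, hy⟩ : ∃ y, y ∉ Submodule.span K (Set.range ![x, 1]) := by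
    by_contra! h
    have := finrank_range_le_card (R := K) ![x, 1]
    rw [Set.finrank, (Submodule.eq_top_iff'.2 h), finrank_top, hA] at this
    simp at this
  have h₃ : LinearIndependent K ![y, x, 1] := linearIndependent_finCons.2 ⟨h₂, hy⟩
  rw [linearIndependent_triple_iff] at h₃
  refine ⟨x, y, linearIndependent_triple_iff.2 fun α β γ h => ?_⟩
  obtain ⟨h₁, h₂, h₃⟩ := h₃ γ β α (by rw [← h]; module)
  exact ⟨h₃, h₂, h₁⟩

theorem exists_mul_self_eq {x y : A} (hli : LinearIndependent K ![1, x, y])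
    (hx : ¬ LinearIndependent K ![1, x, x * x]) : ∃ α β : K, x * x = α • 1 + β • x := by
  rw [linearIndependent_triple_iff] at hli hx
  push Not at hx
  obtain ⟨α, β, γ, h, hne⟩ := hx
  have hγ : γ ≠ 0 := by
    rintro rfl
    obtain ⟨h₁, h₂, -⟩ := hli α β 0 (by rw [← h]; module)
    exact hne h₁ h₂ rfl
  refine ⟨-γ⁻¹ * α, -γ⁻¹ * β, ?_⟩
  have h' := congrArg (γ⁻¹ • ·) h
  simp only [smul_add, smul_smul, inv_mul_cancel₀ hγ, one_smul, smul_zero] at h'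
  rw [← sub_eq_zero, ← h']
  module

/-- Left multiplication by x squares to zero, which forces xy = bx. Associativity then gives l = 0
and b² = β. If b = 0 the algebra is local; otherwise y/b and x satisfy the triangular relations. -/
theorem isStandard_of_mul_self_eq_zero [CharZero K] (hA : Module.finrank K A = 3) {x y : A} {β l : K}
    (hli : LinearIndependent K ![1, x, y]) (hxx : x * x = 0) (hyy : y * y = β • 1)
    (hxy : x * y + y * x = l • 1) : IsStandard K A := by
  have hli' := linearIndependent_triple_iff.1 hli
  obtain ⟨a, b, c, h⟩ : ∃ a b c : K, x * y = a • 1 + b • x + c • y := by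
    have h := (basisTriple hli hA).sum_repr (x * y)
    simp only [coe_basisTriple, Fin.sum_univ_three, Matrix.cons_val] at h
    exact ⟨_, _, _, h.symm⟩
  have h₁ : x * (x * y) = 0 := by rw [← mul_assoc, hxx, zero_mul]
  have h₂ : (c * a) • (1 : A) + (a + c * b) • x + (c * c) • y = 0 := by
    rw [← h₁]
    conv_rhs => rw [h]
    simp only [mul_add, mul_smul_comm, mul_one, hxx, h]
    module
  obtain ⟨-, ha, hc⟩ := hli' _ _ _ h₂
  obtain rfl : c = 0 := by simpa using hc
  obtain rfl : a = 0 := by simpa using ha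
  have hxy' : x * y = b • x := by rw [h]; module
  have hyx : y * x = l • 1 - b • x := by rw [← hxy, hxy']; abel
  have hl : l = 0 := by
    have h₃ : x * (y * x) = 0 := by rw [← mul_assoc, hxy', smul_mul_assoc, hxx, smul_zero]
    rw [hyx] at h₃
    simp only [mul_sub, mul_smul_comm, mul_one, hxx] at h₃
    exact (hli' 0 l 0 (by rw [← h₃]; module)).2.1
  subst hl
  have hβ : b * b = β := by
    have h₃ : x * y * y = x * (y * y) := mul_assoc _ _ _
    rw [hyy, hxy', smul_mul_assoc, hxy', mul_smul_comm, mul_one] at h₃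
    have := (hli' 0 (b * b - β) 0 (by rw [sub_smul, mul_smul, h₃]; module)).2.1
    exact sub_eq_zero.1 this
  by_cases hb : b = 0
  · subst hb
    obtain ⟨b', hb'⟩ := exists_mulLocal hA 0 hli (by simp [hxx]) (by simp [hxy']) (by simp [hyx])
      (by simp [hyy, ← hβ])
    exact ⟨b', .inr (.inr (.inr ⟨_, hb'⟩))⟩
  · have hli₂ : LinearIndependent K ![1, x, b⁻¹ • y] := by
      refine linearIndependent_triple_iff.2 fun α γ δ h => ?_
      obtain ⟨h₁, h₂, h₃⟩ := hli' α γ (δ * b⁻¹) (by rw [← h]; module)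
      exact ⟨h₁, h₂, by simpa [hb] using h₃⟩
    obtain ⟨b', hb'⟩ := exists_mulTriangular hA hli₂ hxx (by simp [hxy', smul_smul, hb])
      (by simp [hyx, smul_smul, hb]) (by simp [hyy, ← hβ, smul_smul, hb])
    exact ⟨b', .inr (.inr (.inl hb'))⟩

/-- Completing the square in the quadratic equation satisfied by x. -/
theorem exists_traceless [CharZero K] (hq : ∀ a : A, ¬ LinearIndependent K ![1, a, a * a]) {x y : A}
    (hli : LinearIndependent K ![1, x, y]) :
    ∃ (x' : A) (α : K), LinearIndependent K ![1, x', y] ∧ x' * x' = α • 1 := by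
  obtain ⟨α, β, h⟩ := exists_mul_self_eq hli (hq x)
  refine ⟨x - (β / 2) • 1, α + β ^ 2 / 4, ?_, ?_⟩
  · rw [linearIndependent_triple_iff] at hli ⊢
    intro a b c habc
    obtain ⟨h₁, rfl, h₃⟩ := hli (a - b * (β / 2)) b c (by rw [← habc]; module)
    exact ⟨by simpa using h₁, rfl, h₃⟩
  · simp only [mul_sub, sub_mul, smul_mul_assoc, mul_smul_comm, mul_one, one_mul, h]
    module

theorem linearIndependent_triple_swap {x y z : A} (h : LinearIndependent K ![z, x, y]) :
    LinearIndependent K ![z, y, x] := by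
  rw [linearIndependent_triple_iff] at h ⊢
  intro a b c habc
  obtain ⟨h₁, h₂, h₃⟩ := h a c b (by rw [← habc]; module)
  exact ⟨h₁, h₃, h₂⟩

/-- On the plane spanned by traceless x and y, squaring is a scalar-valued quadratic form. Over an
algebraically closed field a binary form has an isotropic vector, which gives an element of square
zero. -/
theorem isStandard_of_quadratic [IsAlgClosed K] [CharZero K] (hA : Module.finrank K A = 3)
    (hq : ∀ a : A, ¬ LinearIndependent K ![1, a, a * a]) : IsStandard K A := by
  obtain ⟨x, y, hli⟩ := exists_linearIndependent_one (K := K) hA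
  obtain ⟨x, α, hli, hx⟩ := exists_traceless hq hli
  obtain ⟨y, β, hli, hy⟩ := exists_traceless hq (linearIndependent_triple_swap hli)
  have hli := linearIndependent_triple_swap hli
  have hli' := linearIndependent_triple_iff.1 hli
  -- Both x + y and x - y satisfy quadratic equations; their linear coefficients b and d obey b + d
  -- = b - d = 0, so they vanish.
  obtain ⟨l, hl⟩ : ∃ l : K, x * y + y * x = l • 1 := by
    have h₁ : LinearIndependent K ![1, x + y, y] := by
      refine linearIndependent_triple_iff.2 fun a b c habc => ?_
      obtain ⟨h₁, rfl, h₃⟩ := hli' a b (b + c) (by rw [← habc]; module)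
      exact ⟨h₁, rfl, by simpa using h₃⟩
    have h₂ : LinearIndependent K ![1, x - y, y] := by
      refine linearIndependent_triple_iff.2 fun a b c habc => ?_
      obtain ⟨h₁, rfl, h₃⟩ := hli' a b (c - b) (by rw [← habc]; module)
      exact ⟨h₁, rfl, by simpa using h₃⟩
    obtain ⟨a, b, hab⟩ := exists_mul_self_eq h₁ (hq _)
    obtain ⟨c, d, hcd⟩ := exists_mul_self_eq h₂ (hq _)
    have h₃ : x * y + y * x = (a - α - β) • 1 + b • (x + y) := by
      rw [sub_smul, sub_smul, ← hx, ← hy]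
      have : (x + y) * (x + y) = x * x + y * y + (x * y + y * x) := by noncomm_ring
      rw [hab] at this
      rw [← sub_eq_zero, ← sub_eq_zero.2 this.symm]
      abel
    have h₄ : -(x * y + y * x) = (c - α - β) • 1 + d • (x - y) := by
      rw [sub_smul, sub_smul, ← hx, ← hy]
      have : (x - y) * (x - y) = x * x + y * y - (x * y + y * x) := by noncomm_ring
      rw [hcd] at this
      rw [← sub_eq_zero, ← sub_eq_zero.2 this.symm]
      abel
    rw [h₃] at h₄
    obtain ⟨-, h₅, h₆⟩ := hli' (a - α - β + (c - α - β)) (b + d) (b - d) (by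
      rw [← sub_eq_zero.2 h₄.symm]; module)
    have hb : b = 0 := by
      have : (2 : K) * b = 0 := by linear_combination h₅ + h₆
      simpa using this
    exact ⟨a - α - β, by rw [h₃, hb]; module⟩
  by_cases hα : α = 0
  · subst hα
    exact isStandard_of_mul_self_eq_zero hA hli (by simpa using hx) hy hl
  · obtain ⟨δ, hδ⟩ := IsAlgClosed.exists_pow_nat_eq (l ^ 2 - 4 * α * β) two_pos
    -- The equation says (kx + y)² = 0.
    obtain ⟨k, hk⟩ : ∃ k : K, k ^ 2 * α + k * l + β = 0 := by
      refine ⟨(δ - l) / (2 * α), ?_⟩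
      field_simp
      linear_combination hδ
    have hli₂ : LinearIndependent K ![1, k • x + y, x] := by
      refine linearIndependent_triple_iff.2 fun a b c habc => ?_
      obtain ⟨h₁, h₂, rfl⟩ := hli' a (b * k + c) b (by rw [← habc]; module)
      exact ⟨h₁, rfl, by simpa using h₂⟩
    refine isStandard_of_mul_self_eq_zero (l := 2 * k * α + l) hA hli₂ ?_ hx ?_
    · have : (k • x + y) * (k • x + y) = (k * k) • (x * x) + k • (x * y + y * x) + y * y := by
        simp only [mul_add, add_mul, smul_mul_assoc, mul_smul_comm, smul_smul, smul_add]
        abel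
      rw [this, hx, hl, hy, smul_smul, smul_smul, ← add_smul, ← add_smul]
      rw [show k * k * α + k * l + β = 0 by linear_combination hk, zero_smul]
    · have : (k • x + y) * x + x * (k • x + y) = (2 * k) • (x * x) + (x * y + y * x) := by
        simp only [mul_add, add_mul, smul_mul_assoc, mul_smul_comm]
        module
      rw [this, hx, hl]
      module

theorem isStandard [IsAlgClosed K] [CharZero K] (hA : Module.finrank K A = 3) :
    IsStandard K A := by
  by_cases h : ∃ a : A, LinearIndependent K ![1, a, a * a]
  · obtain ⟨a, ha⟩ := h
    exact isStandard_of_linearIndependent hA ha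
  · exact isStandard_of_quadratic hA (not_exists.1 h)

end AlgebraDimThree

/-! ### Assembling the classification. -/

namespace WeakBialgebraData
open StructureConstants WeakBialgebraDimThree

theorem exists_isomorphic_structures {V : Type*} [AddCommGroup V] [Module ℂ V]
    (hV : Module.finrank ℂ V = 3) {B : WeakBialgebraData ℂ V} (hB : B.IsWeakBialgebra) :
    ∃ i : Fin 20, B.Isomorphic (structures i) := by
  -- The additive group of `V` is kept and the product is `B.mul` by definition, so tables for the
  -- ring serve directly as tables for `B`.
  letI : Ring V :=
    { (inferInstance : AddCommGroup V) with
      mul := fun x y => B.mul x y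
      one := B.one
      mul_assoc := hB.mul_assoc
      one_mul := hB.one_mul
      mul_one := hB.mul_one
      left_distrib := fun x y z => map_add (B.mul x) y z
      right_distrib := fun x y z => LinearMap.congr_fun (map_add B.mul x y) z
      zero_mul := fun x => LinearMap.congr_fun (map_zero B.mul) x
      mul_zero := fun x => map_zero (B.mul x) }
  letI : Algebra ℂ V := Algebra.ofModule
    (fun r x y => LinearMap.congr_fun (map_smul B.mul r x) y) (fun r x y => map_smul (B.mul x) r y)
  obtain ⟨b, h | h | h | ⟨s, h⟩⟩ := AlgebraDimThree.isStandard (K := ℂ) (A := V) hV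
  · obtain ⟨d, e, hc⟩ := B.exists_hasConstants b _ _ h.1 h.2
    exact isomorphic_of_mulDiag hB hc
  · obtain ⟨d, e, hc⟩ := B.exists_hasConstants b _ _ h.1 h.2
    exact isomorphic_of_mulDual hB hc
  · obtain ⟨d, e, hc⟩ := B.exists_hasConstants b _ _ h.1 h.2
    exact isomorphic_of_mulTriangular hB hc
  · obtain ⟨d, e, hc⟩ := B.exists_hasConstants b _ _ h.1 h.2
    exact absurd (hc.isCompatible hB) (not_isCompatible_mulLocal s)

end WeakBialgebraData

theorem proposition4p5 :
    (∀ i : Fin 20, (WeakBialgebraDimThree.structures i).IsWeakBialgebra) ∧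
    ∀ (V : Type*) [AddCommGroup V] [Module ℂ V], Module.finrank ℂ V = 3 →
      ∀ B : WeakBialgebraData ℂ V, B.IsWeakBialgebra →
        ∃ i : Fin 20, B.Isomorphic (WeakBialgebraDimThree.structures i) := by
  exact ⟨WeakBialgebraDimThree.isWeakBialgebra_structures, fun _ _ _ hV _ hB =>
    WeakBialgebraData.exists_isomorphic_structures hV hB⟩
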